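/- Let $n\ge 1$ and let $G$ be a finite directed acyclic multigraph (parallel edges allowed) on the vertices $1,\dots,n+1$, all of whose edges $(i,j)$ satisfy $i<j$, with out-degree sequence $(3,2,\dots,2,0)$ and in-degree sequence $(0,2,\dots,2,3)$; that is, $G\in\mathscr{F}_{n,3}$. A strongly planar realization of $G$ is a drawing of $G$ in $\mathbb{R}^2$ with vertices at distinct points, in which every edge $(i,j)$ goes strictly from left to right and is the graph of a piecewise differentiable function of $x$ (continuous on the closed interval between the abscissas of its ends, and differentiable in its interior except at finitely many points), no edge passes through a vertex other than its ends, and distinct edges meet only at common ends. The faces of the drawing are the connected components of its complement. The truncated dual $G^*$ of the drawing is the multigraph whose vertices are the bounded faces, with one edge for each edge $e$ of $G$ both of whose sides lie in bounded faces, joining the face below $e$ to the face above $e$. Then $G$ has a strongly planar realization, and for every strongly planar realization of $G$ the truncated dual $G^*$ is a bipartite non-crossing tree on $n+1$ vertices. That is: $G^*$ has exactly $n+1$ vertices; $G^*$ is a tree (in particular it has no loops and no parallel edges); there is an assignment of a rank in $\{0,1\}$ to each bounded face such that every edge of $G^*$ goes from a face of rank $0$ (below the corresponding edge of $G$) to a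 face of rank $1$ (above it); and, for every choice of a point $p_F\in F$ in each bounded face $F$, placing $F$ at the point $(x(p_F),\operatorname{rank}F)$ and drawing the edges of $G^*$ as straight segments gives a drawing in which distinct vertices are at distinct points and distinct edges meet at most at a common end. -/

import Mathlib

/-- A directed acyclic multigraph on the vertices `0 < 1 < ⋯ < n` (that is, `[n + 1]` with labels
shifted by one) with edge type `E`, all of whose edges point from a smaller to a larger vertex.
Distinct elements of `E` may be parallel edges. -/
structure OrderedDAG (n : ℕ) (E : Type*) where
  src : E → Fin (n + 1)
  tgt : E → Fin (n + 1)
  src_lt_tgt : ∀ e, src e < tgt e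

namespace OrderedDAG

variable {n : ℕ} {E : Type*}

/-- The out-degree of a vertex, parallel edges being counted separately. -/
noncomputable def outDegree (G : OrderedDAG n E) (v : Fin (n + 1)) : ℕ := Nat.card {e // G.src e = v}

/-- The in-degree of a vertex, parallel edges being counted separately. -/
noncomputable def inDegree (G : OrderedDAG n E) (v : Fin (n + 1)) : ℕ := Nat.card {e // G.tgt e = v}

/-- Membership in the family of full DAGs whose source has out-degree `k`: the out-degree sequence
is `(k, 2, …, 2, 0)` and the in-degree sequence is `(0, 2, …, 2, k)`. -/
structure IsFull (G : OrderedDAG n E) (k : ℕ) : Prop where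
  out_source : G.outDegree 0 = k
  in_source : G.inDegree 0 = 0
  out_sink : G.outDegree (Fin.last n) = 0
  in_sink : G.inDegree (Fin.last n) = k
  out_inner : ∀ v, v ≠ 0 → v ≠ Fin.last n → G.outDegree v = 2
  in_inner : ∀ v, v ≠ 0 → v ≠ Fin.last n → G.inDegree v = 2

/-- The two end vertices of an edge. -/
def ends (G : OrderedDAG n E) (e : E) : Set (Fin (n + 1)) := {G.src e, G.tgt e}

end OrderedDAG

/-- `f` is continuous on `[a, b]`, and differentiable at all but finitely many points of
`(a, b)`. -/
def PiecewiseDifferentiableOn (f : ℝ → ℝ) (a b : ℝ) : Prop :=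
  ContinuousOn f (Set.Icc a b) ∧
    ∃ s : Set ℝ, s.Finite ∧ ∀ x ∈ Set.Ioo a b \ s, DifferentiableAt ℝ f x

/-- A strongly planar realization of a DAG: a crossing-free drawing in the plane, such that every
edge goes strictly from left to right and is the graph of a piecewise differentiable function
of `x`. -/
structure StronglyPlanarRealization {n : ℕ} {E : Type*} (G : OrderedDAG n E) where
  /-- the point at which a vertex is drawn -/
  pos : Fin (n + 1) → ℝ × ℝ
  /-- the function whose graph over `[x(src e), x(tgt e)]` is the drawing of the edge `e` -/
  curve : E → ℝ → ℝ
  pos_injective : Function.Injective pos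
  left_to_right : ∀ e, (pos (G.src e)).1 < (pos (G.tgt e)).1
  curve_src : ∀ e, curve e (pos (G.src e)).1 = (pos (G.src e)).2
  curve_tgt : ∀ e, curve e (pos (G.tgt e)).1 = (pos (G.tgt e)).2
  curve_piecewise : ∀ e,
    PiecewiseDifferentiableOn (curve e) (pos (G.src e)).1 (pos (G.tgt e)).1
  /-- an edge passes through no vertex other than its ends -/
  vertex_on_edge : ∀ v e, (pos v).1 ∈ Set.Icc (pos (G.src e)).1 (pos (G.tgt e)).1 →
    curve e (pos v).1 = (pos v).2 → v ∈ G.ends e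
  /-- distinct edges meet only at common end vertices -/
  edges_meet : ∀ e e', e ≠ e' → ∀ x, x ∈ Set.Icc (pos (G.src e)).1 (pos (G.tgt e)).1 →
    x ∈ Set.Icc (pos (G.src e')).1 (pos (G.tgt e')).1 → curve e x = curve e' x →
    ∃ v ∈ G.ends e ∩ G.ends e', pos v = (x, curve e x)

namespace StronglyPlanarRealization

variable {n : ℕ} {E : Type*} {G : OrderedDAG n E}

/-- The set of abscissas of the interior points of the edge `e`. -/
def span (R : StronglyPlanarRealization G) (e : E) : Set ℝ :=
  Set.Ioo (R.pos (G.src e)).1 (R.pos (G.tgt e)).1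

/-- The closed arc by which the edge `e` is drawn. -/
def arc (R : StronglyPlanarRealization G) (e : E) : Set (ℝ × ℝ) :=
  (fun x => (x, R.curve e x)) '' Set.Icc (R.pos (G.src e)).1 (R.pos (G.tgt e)).1

/-- The union of all vertices and edges of the drawing. -/
def drawing (R : StronglyPlanarRealization G) : Set (ℝ × ℝ) :=
  Set.range R.pos ∪ ⋃ e, R.arc e

/-- The faces (regions) of the drawing: the connected components of its complement. -/
def faces (R : StronglyPlanarRealization G) : Set (Set (ℝ × ℝ)) :=
  {F | ∃ p ∈ R.drawingᶜ, F = connectedComponentIn R.drawingᶜ p}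

/-- The face `F` is the one directly below the edge `e`. -/
def IsBelow (R : StronglyPlanarRealization G) (F : Set (ℝ × ℝ)) (e : E) : Prop :=
  F ∈ R.faces ∧
    ∀ x ∈ R.span e, ∀ᶠ ε in nhdsWithin (0 : ℝ) (Set.Ioi 0), (x, R.curve e x - ε) ∈ F

/-- The face `F` is the one directly above the edge `e`. -/
def IsAbove (R : StronglyPlanarRealization G) (F : Set (ℝ × ℝ)) (e : E) : Prop :=
  F ∈ R.faces ∧
    ∀ x ∈ R.span e, ∀ᶠ ε in nhdsWithin (0 : ℝ) (Set.Ioi 0), (x, R.curve e x + ε) ∈ F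

theorem faces_eq_of_mem (R : StronglyPlanarRealization G) {F F' : Set (ℝ × ℝ)}
    (hF : F ∈ R.faces) (hF' : F' ∈ R.faces) {p : ℝ × ℝ} (h : p ∈ F) (h' : p ∈ F') : F = F' := by
  obtain ⟨a, -, rfl⟩ := hF
  obtain ⟨b, -, rfl⟩ := hF'
  rw [connectedComponentIn_eq h, connectedComponentIn_eq h']

theorem IsBelow.eq {R : StronglyPlanarRealization G} {F F' : Set (ℝ × ℝ)} {e : E}
    (h : R.IsBelow F e) (h' : R.IsBelow F' e) : F = F' := by
  obtain ⟨x, hx⟩ := Set.nonempty_Ioo.2 (R.left_to_right e)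
  obtain ⟨ε, h1, h2⟩ := ((h.2 x hx).and (h'.2 x hx)).exists
  exact R.faces_eq_of_mem h.1 h'.1 h1 h2

theorem IsAbove.eq {R : StronglyPlanarRealization G} {F F' : Set (ℝ × ℝ)} {e : E}
    (h : R.IsAbove F e) (h' : R.IsAbove F' e) : F = F' := by
  obtain ⟨x, hx⟩ := Set.nonempty_Ioo.2 (R.left_to_right e)
  obtain ⟨ε, h1, h2⟩ := ((h.2 x hx).and (h'.2 x hx)).exists
  exact R.faces_eq_of_mem h.1 h'.1 h1 h2

/-- The dual multigraph: its vertices are the faces, and every edge `e` of the DAG gives one dual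
edge (again called `e`), which joins the faces on the two sides of `e`. -/
def dual (R : StronglyPlanarRealization G) : Graph (Set (ℝ × ℝ)) E where
  vertexSet := R.faces
  IsLink e F F' := (R.IsBelow F e ∧ R.IsAbove F' e) ∨ (R.IsBelow F' e ∧ R.IsAbove F e)
  isLink_symm := fun _ _ => ⟨fun _ _ h => h.symm⟩
  eq_or_eq_of_isLink_of_isLink := by
    rintro e F F' H H' (⟨h1, h2⟩ | ⟨h1, h2⟩) (⟨h3, h4⟩ | ⟨h3, h4⟩)
    · exact Or.inl (h1.eq h3)
    · exact Or.inr (h1.eq h3)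
    · exact Or.inr (h2.eq h4)
    · exact Or.inl (h2.eq h4)
  left_mem_of_isLink := by
    rintro e F F' (⟨h1, -⟩ | ⟨-, h2⟩)
    · exact h1.1
    · exact h2.1

/-- The truncated dual: the dual multigraph with the unbounded (outer) face deleted, together with
all dual edges incident to it. -/
def truncatedDual (R : StronglyPlanarRealization G) : Graph (Set (ℝ × ℝ)) E :=
  R.dual.deleteVerts {F | ¬ Bornology.IsBounded F}

end StronglyPlanarRealization

namespace Graph

variable {α β : Type*}

/-- A multigraph is a tree if it has no loops and no parallel edges and is a tree as a
simple graph. -/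
def IsMultigraphTree (T : Graph α β) : Prop :=
  T.Simple ∧ T.toSimpleGraph.IsTree

/-- Placing the vertices at the points `pos` and drawing the edges as straight segments gives a
non-crossing drawing of `T` as a bipartite graph: the vertices are distinct points on the two lines
`y = 0` and `y = 1`, every edge joins the two lines, and distinct edges meet at most in a
common end. -/
structure IsBipartiteNoncrossing (T : Graph α β) (pos : α → ℝ × ℝ) : Prop where
  injOn : Set.InjOn pos T.vertexSet
  two_rows : ∀ v ∈ T.vertexSet, (pos v).2 = 0 ∨ (pos v).2 = 1
  bipartite : ∀ e u v, T.IsLink e u v → (pos u).2 ≠ (pos v).2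
  noncrossing : ∀ e e' u v u' v', T.IsLink e u v → T.IsLink e' u' v' → e ≠ e' →
    segment ℝ (pos u) (pos v) ∩ segment ℝ (pos u') (pos v') ⊆ pos '' ({u, v} ∩ {u', v'})

end Graph

/-!
In a full DAG whose source has out-degree `3`, each of the `n` cuts between consecutive vertices
consists of three edges (`OrderedDAG.IsFull.ncard_cut`). By the pigeonhole principle one of them
joins the two consecutive vertices (`exists_short_edge`), and at every inner vertex two of the
three edges end, one passes by, and two new ones start (`exists_passing_edge`).

For the existence of a drawing, link every edge that ends at an inner vertex to one that starts
there: the edges fall into three paths from the source to the sink, one of which runs through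
all vertices (`exists_coloring`). Draw that path on the `x`-axis, one of the others by arcs above
the axis and the remaining one by arcs below it (`nonempty_realization`).

Conversely, in any drawing the short edges force the vertices to appear in their given order from
left to right, so that exactly three edges lie over the interval between two consecutive abscissas,
in a constant vertical order (`exists_isSortedCut`). The edge that passes by a vertex cannot be the
middle one, because the other two come together there; hence the middle edges run from vertex to
vertex, and at each inner vertex either the two lower or the two upper edges meet
(`IsSortedCut.at_vertex`). So the drawing consists of the graphs of three continuous functions
`L ≤ M ≤ H`, where each inner vertex is a point at which exactly one of `L` and `H` touches `M`
(`IsStrandSystem`). The bounded faces are the pieces into which the strips between `L` and `M` and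
between `M` and `H` are cut at these points (`mem_vertexSet_truncatedDual`), and the `k`-th
middle edge is the `k`-th edge of the truncated dual. From one middle edge to the next, one of its
two faces stays while the other is replaced by a new face further to the right
(`isTwoRowCaterpillar`). A graph built up in this way is connected, with `n + 1` vertices and
`n` edges, hence a tree, and its edges do not cross because the faces in each row appear in the
order of their abscissas (`Graph.IsTwoRowCaterpillar.isBipartiteNoncrossing`).
-/

/-! ### Strips between two functions, cut at the points where they touch -/

theorem exists_mem_Icc_succ {X : ℕ → ℝ} {x : ℝ} {i j : ℕ} (hi : X i ≤ x) (hj : x ≤ X j)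
    (hij : i < j) : ∃ k, i ≤ k ∧ k < j ∧ x ∈ Set.Icc (X k) (X (k + 1)) := by
  induction j, hij using Nat.le_induction with
  | base => exact ⟨i, le_rfl, i.lt_succ_self, hi, hj⟩
  | succ j hij ih =>
    rcases le_or_gt x (X j) with hx | hx
    · obtain ⟨k, hk1, hk2, hk3⟩ := ih hx
      exact ⟨k, hk1, hk2.trans j.lt_succ_self, hk3⟩
    · exact ⟨j, by omega, j.lt_succ_self, hx.le, hj⟩

/-- The strip between the graphs of `f ≤ g` over `[X 0, X n]`, pinched at both ends; in between,
`f` and `g` touch at most at the abscissas `X v`. -/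
structure IsPinchedStrip (f g : ℝ → ℝ) (X : ℕ → ℝ) (n : ℕ) : Prop where
  continuous_lower : Continuous f
  continuous_upper : Continuous g
  strictMono : ∀ i j, i < j → j ≤ n → X i < X j
  le : ∀ x ∈ Set.Icc (X 0) (X n), f x ≤ g x
  eq_abscissa : ∀ x ∈ Set.Icc (X 0) (X n), f x = g x → ∃ v ≤ n, x = X v
  pinch_left : f (X 0) = g (X 0)
  pinch_right : f (X n) = g (X n)

/-- The abscissas that are separated from `(X k, X (k + 1))` by no pinch point. -/
def stripBase (f g : ℝ → ℝ) (X : ℕ → ℝ) (n k : ℕ) : Set ℝ :=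
  {x | ∀ v ≤ n, f (X v) = g (X v) → (v ≤ k → X v < x) ∧ (k < v → x < X v)}

/-- The component of the pinched strip between `f` and `g` that contains the part over
`(X k, X (k + 1))`. -/
def stripCell (f g : ℝ → ℝ) (X : ℕ → ℝ) (n k : ℕ) : Set (ℝ × ℝ) :=
  {p | p.1 ∈ stripBase f g X n k ∧ f p.1 < p.2 ∧ p.2 < g p.1}

namespace IsPinchedStrip

variable {f g : ℝ → ℝ} {X : ℕ → ℝ} {n k : ℕ}

theorem mono (h : IsPinchedStrip f g X n) {i j : ℕ} (hij : i ≤ j) (hj : j ≤ n) : X i ≤ X j := by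
  rcases hij.eq_or_lt with rfl | hij
  · exact le_rfl
  · exact (h.strictMono i j hij hj).le

theorem base_subset (h : IsPinchedStrip f g X n) (hk : k < n) :
    stripBase f g X n k ⊆ Set.Ioo (X 0) (X n) := fun _ hx =>
  ⟨(hx 0 (Nat.zero_le n) h.pinch_left).1 (Nat.zero_le k), (hx n le_rfl h.pinch_right).2 hk⟩

theorem lt_of_ne (h : IsPinchedStrip f g X n) {x : ℝ} (hx : x ∈ Set.Icc (X 0) (X n))
    (hne : ∀ v ≤ n, f (X v) = g (X v) → x ≠ X v) : f x < g x := by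
  refine lt_of_le_of_ne (h.le x hx) fun he => ?_
  obtain ⟨v, hv, rfl⟩ := h.eq_abscissa x hx he
  exact hne v hv he rfl

theorem lt_of_mem_base (h : IsPinchedStrip f g X n) (hk : k < n) {x : ℝ}
    (hx : x ∈ stripBase f g X n k) : f x < g x := by
  refine h.lt_of_ne (Set.Ioo_subset_Icc_self (h.base_subset hk hx)) fun v hv hp he => ?_
  rcases le_or_gt v k with hvk | hvk
  · exact ((hx v hv hp).1 hvk).ne' he
  · exact ((hx v hv hp).2 hvk).ne he

theorem Ioo_subset_base (h : IsPinchedStrip f g X n) (hk : k < n) :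
    Set.Ioo (X k) (X (k + 1)) ⊆ stripBase f g X n k := fun _ hx _ hv _ =>
  ⟨fun hvk => (h.mono hvk hk.le).trans_lt hx.1, fun hkv => hx.2.trans_le (h.mono hkv hv)⟩

theorem mem_cell (h : IsPinchedStrip f g X n) (hk : k < n) {p : ℝ × ℝ}
    (hx : p.1 ∈ Set.Ioo (X k) (X (k + 1))) (h1 : f p.1 < p.2) (h2 : p.2 < g p.1) :
    p ∈ stripCell f g X n k :=
  ⟨h.Ioo_subset_base hk hx, h1, h2⟩

theorem exists_mem_cell (h : IsPinchedStrip f g X n) (hk : k < n) :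
    ∃ p ∈ stripCell f g X n k, p.1 ∈ Set.Ioo (X k) (X (k + 1)) := by
  obtain ⟨x, hx⟩ := Set.nonempty_Ioo.2 (h.strictMono k (k + 1) k.lt_succ_self hk)
  have hlt := h.lt_of_mem_base hk (h.Ioo_subset_base hk hx)
  exact ⟨(x, (f x + g x) / 2), h.mem_cell hk hx (by dsimp; linarith) (by dsimp; linarith), hx⟩

theorem isOpen_cell (h : IsPinchedStrip f g X n) : IsOpen (stripCell f g X n k) := by
  have hb : IsOpen (stripBase f g X n k) := by
    have : stripBase f g X n k = ⋂ v ∈ Set.Iic n,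
        {x | f (X v) = g (X v) → (v ≤ k → X v < x) ∧ (k < v → x < X v)} := by
      ext x; simp [stripBase]
    rw [this]
    refine (Set.finite_Iic n).isOpen_biInter fun v _ => ?_
    by_cases hp : f (X v) = g (X v)
    · rcases le_or_gt v k with hvk | hvk
      · simpa [hp, hvk] using isOpen_lt continuous_const continuous_id
      · simpa [hp, hvk, not_le.2 hvk] using isOpen_lt continuous_id continuous_const
    · simp [hp]
  exact (hb.preimage continuous_fst).inter
    ((isOpen_lt (h.continuous_lower.comp continuous_fst) continuous_snd).inter
      (isOpen_lt continuous_snd (h.continuous_upper.comp continuous_fst)))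

/-- A cell is the image of the product of an interval with `(0, 1)`. -/
theorem isPreconnected_cell (h : IsPinchedStrip f g X n) (hk : k < n) :
    IsPreconnected (stripCell f g X n k) := by
  have hb : (stripBase f g X n k).OrdConnected := by
    refine ⟨fun x hx y hy z hz v hv hp => ⟨fun hvk => ?_, fun hkv => ?_⟩⟩
    · exact ((hx v hv hp).1 hvk).trans_le hz.1
    · exact hz.2.trans_lt ((hy v hv hp).2 hkv)
  have himg : stripCell f g X n k =
      (fun q : ℝ × ℝ => (q.1, f q.1 + q.2 * (g q.1 - f q.1))) ''
        (stripBase f g X n k ×ˢ Set.Ioo 0 1) := by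
    ext ⟨x, y⟩
    constructor
    · rintro ⟨hx, h1, h2⟩
      dsimp at hx h1 h2
      have hd : 0 < g x - f x := sub_pos.2 (h.lt_of_mem_base hk hx)
      refine ⟨(x, (y - f x) / (g x - f x)), ⟨hx, div_pos (sub_pos.2 h1) hd, ?_⟩, ?_⟩
      · rw [div_lt_one hd]; linarith
      · simp [div_mul_cancel₀ _ hd.ne']
    · rintro ⟨⟨x', t⟩, ⟨hx, h1, h2⟩, he⟩
      obtain ⟨rfl, rfl⟩ := Prod.mk.inj he
      have hd : 0 < g x' - f x' := sub_pos.2 (h.lt_of_mem_base hk hx)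
      dsimp at hx h1 h2
      refine ⟨hx, ?_, ?_⟩ <;> dsimp <;> nlinarith
  rw [himg]
  have hf := h.continuous_lower
  have hg := h.continuous_upper
  exact (hb.isPreconnected.prod isPreconnected_Ioo).image _
    (Continuous.continuousOn (by fun_prop))

theorem isBounded_cell (h : IsPinchedStrip f g X n) (hk : k < n) :
    Bornology.IsBounded (stripCell f g X n k) := by
  obtain ⟨a, ha⟩ := (isCompact_Icc (a := X 0) (b := X n)).bddBelow_image
    h.continuous_lower.continuousOn
  obtain ⟨b, hb⟩ := (isCompact_Icc (a := X 0) (b := X n)).bddAbove_image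
    h.continuous_upper.continuousOn
  refine ((Metric.isBounded_Icc (X 0) (X n)).prod (Metric.isBounded_Icc a b)).subset ?_
  rintro p ⟨hx, h1, h2⟩
  have hx := Set.Ioo_subset_Icc_self (h.base_subset hk hx)
  exact ⟨hx, (ha ⟨_, hx, rfl⟩).trans h1.le, h2.le.trans (hb ⟨_, hx, rfl⟩)⟩

/-- The boundary of a cell consists of points of the graphs of `f` and `g`. -/
theorem closure_cell_inter_subset (h : IsPinchedStrip f g X n) (hk : k < n) {S : Set (ℝ × ℝ)}
    (hf : ∀ p ∈ S, p.1 ∈ Set.Icc (X 0) (X n) → p.2 ≠ f p.1)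
    (hg : ∀ p ∈ S, p.1 ∈ Set.Icc (X 0) (X n) → p.2 ≠ g p.1) :
    closure (stripCell f g X n k) ∩ S ⊆ stripCell f g X n k := by
  rintro p ⟨hp, hpS⟩
  have hcl : ∀ {C : Set (ℝ × ℝ)}, IsClosed C → stripCell f g X n k ⊆ C → p ∈ C :=
    fun hC hsub => closure_minimal hsub hC hp
  have hx : p.1 ∈ Set.Icc (X 0) (X n) :=
    hcl (C := Prod.fst ⁻¹' Set.Icc (X 0) (X n)) (isClosed_Icc.preimage continuous_fst)
      fun q hq => Set.Ioo_subset_Icc_self (h.base_subset hk hq.1)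
  have h1 : f p.1 < p.2 := lt_of_le_of_ne
    (hcl (C := {q | f q.1 ≤ q.2})
      (isClosed_le (h.continuous_lower.comp continuous_fst) continuous_snd)
      fun q hq => hq.2.1.le) (hf p hpS hx).symm
  have h2 : p.2 < g p.1 := lt_of_le_of_ne
    (hcl (C := {q | q.2 ≤ g q.1})
      (isClosed_le continuous_snd (h.continuous_upper.comp continuous_fst))
      fun q hq => hq.2.2.le) (hg p hpS hx)
  refine ⟨fun v hv hpv => ?_, h1, h2⟩
  have hne : p.1 ≠ X v := fun he => by rw [he] at h1 h2; linarith
  refine ⟨fun hvk => lt_of_le_of_ne ?_ hne.symm, fun hkv => lt_of_le_of_ne ?_ hne⟩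
  · exact hcl (C := {q | X v ≤ q.1}) (isClosed_le continuous_const continuous_fst)
      fun q hq => ((hq.1 v hv hpv).1 hvk).le
  · exact hcl (C := {q | q.1 ≤ X v}) (isClosed_le continuous_fst continuous_const)
      fun q hq => ((hq.1 v hv hpv).2 hkv).le

theorem cell_congr {j : ℕ} (hjk : j ≤ k)
    (h : ∀ v, j < v → v ≤ k → v ≤ n → f (X v) ≠ g (X v)) :
    stripCell f g X n j = stripCell f g X n k := by
  have : stripBase f g X n j = stripBase f g X n k := by
    ext x
    refine forall₃_congr fun v hv hp => ?_
    have hne : ¬ (j < v ∧ v ≤ k) := fun he => h v he.1 he.2 hv hp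
    have h1 : v ≤ j ↔ v ≤ k := by omega
    have h2 : j < v ↔ k < v := by omega
    rw [h1, h2]
  simp only [stripCell, this]

/-- A pinch point between two cells separates them. -/
theorem cell_lt_cell {v j : ℕ} (hv : v ≤ n) (hp : f (X v) = g (X v)) (hj : j < v)
    (hk : v ≤ k) {p q : ℝ × ℝ} (hpj : p ∈ stripCell f g X n j) (hqk : q ∈ stripCell f g X n k) :
    p.1 < q.1 :=
  ((hpj.1 v hv hp).2 hj).trans ((hqk.1 v hv hp).1 hk)

theorem cell_eq_or_lt {j : ℕ} (hjk : j ≤ k) :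
    stripCell f g X n j = stripCell f g X n k ∨
      ∀ p ∈ stripCell f g X n j, ∀ q ∈ stripCell f g X n k, p.1 < q.1 := by
  by_cases h : ∃ v, j < v ∧ v ≤ k ∧ v ≤ n ∧ f (X v) = g (X v)
  · obtain ⟨v, h1, h2, h3, h4⟩ := h
    exact Or.inr fun p hp q hq => cell_lt_cell h3 h4 h1 h2 hp hq
  · push Not at h
    exact Or.inl (cell_congr hjk h)

theorem exists_cell (h : IsPinchedStrip f g X n) {p : ℝ × ℝ} (hx : p.1 ∈ Set.Icc (X 0) (X n))
    (h1 : f p.1 < p.2) (h2 : p.2 < g p.1) : ∃ k < n, p ∈ stripCell f g X n k := by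
  have hne : ∀ v, f (X v) = g (X v) → p.1 ≠ X v := fun v hv he => by
    rw [he] at h1 h2; linarith
  obtain ⟨k, -, hk, hk1, hk2⟩ := exists_mem_Icc_succ hx.1
    (lt_of_le_of_ne hx.2 (hne n h.pinch_right)).le
    (Nat.pos_of_ne_zero fun h0 => hne 0 h.pinch_left (le_antisymm (h0 ▸ hx.2) hx.1))
  refine ⟨k, hk, fun v hv hp => ⟨fun hvk => ?_, fun hkv => ?_⟩, h1, h2⟩
  · exact lt_of_le_of_ne ((h.mono hvk hk.le).trans hk1) (hne v hp).symm
  · exact lt_of_le_of_ne (hk2.trans (h.mono hkv hv)) (hne v hp)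

end IsPinchedStrip

/-- An open connected subset of `S` that contains its limit points in `S` is a component. -/
theorem connectedComponentIn_eq_of_closure_inter_subset {α : Type*} [TopologicalSpace α]
    {S U : Set α} {p : α} (hU : IsOpen U) (hc : IsPreconnected U) (hsub : U ⊆ S)
    (hcl : closure U ∩ S ⊆ U) (hp : p ∈ U) : connectedComponentIn S p = U := by
  refine Set.Subset.antisymm ?_ (hc.subset_connectedComponentIn hp hsub)
  refine isPreconnected_connectedComponentIn.subset_of_closure_inter_subset hU
    ⟨p, mem_connectedComponentIn (hsub hp), hp⟩ ?_
  exact (Set.inter_subset_inter_right _ (connectedComponentIn_subset S p)).trans hcl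

/-- Continuous functions on consecutive intervals that agree at the joints fit together to a
continuous function on the line. -/
theorem exists_continuous_glue (X : ℕ → ℝ) (n : ℕ) (hX : ∀ k < n, X k < X (k + 1))
    (φ : ℕ → ℝ → ℝ) (hφ : ∀ k < n, ContinuousOn (φ k) (Set.Icc (X k) (X (k + 1))))
    (hjoint : ∀ k, k + 1 < n → φ k (X (k + 1)) = φ (k + 1) (X (k + 1))) :
    ∃ f : ℝ → ℝ, Continuous f ∧ ∀ k < n, ∀ x ∈ Set.Icc (X k) (X (k + 1)), f x = φ k x := by
  have hX' : ∀ j, j ≤ n → ∀ i ≤ j, X i ≤ X j := by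
    intro j
    induction j with
    | zero => intro _ i hi; rw [Nat.le_zero.1 hi]
    | succ j ih =>
      intro hj i hi
      rcases hi.eq_or_lt with rfl | hi
      · exact le_rfl
      · exact (ih (by omega) i (by omega)).trans (hX j (by omega)).le
  suffices H : ∀ m ≤ n, ∃ f : ℝ → ℝ, Continuous f ∧
      ∀ k < m, ∀ x ∈ Set.Icc (X k) (X (k + 1)), f x = φ k x from H n le_rfl
  intro m
  induction m with
  | zero => exact fun _ => ⟨fun _ => 0, continuous_const, by simp⟩
  | succ m ih =>
    intro hm
    obtain ⟨f, hf, hfe⟩ := ih (by omega)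
    have hlt := hX m hm
    -- the next function, extended by constants on both sides
    have hext : Continuous (Set.IccExtend hlt.le (Set.domRestrict _ (φ m))) :=
      (continuousOn_iff_continuous_domRestrict.1 (hφ m hm)).Icc_extend'
    rcases Nat.eq_zero_or_pos m with rfl | hm0
    · refine ⟨_, hext, fun k hk x hx => ?_⟩
      obtain rfl : k = 0 := by omega
      rw [Set.IccExtend_of_mem _ _ hx]; rfl
    obtain ⟨l, rfl⟩ : ∃ l, m = l + 1 := ⟨m - 1, by omega⟩
    have hfm : f (X (l + 1)) = φ (l + 1) (X (l + 1)) := by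
      rw [hfe l (by omega) _ (Set.right_mem_Icc.2 (hX l (by omega)).le), hjoint l (by omega)]
    refine ⟨fun x => f (min x (X (l + 1))) +
      (Set.IccExtend hlt.le (Set.domRestrict _ (φ (l + 1))) x - φ (l + 1) (X (l + 1))),
      (hf.comp (continuous_id.min continuous_const)).add (hext.sub continuous_const), ?_⟩
    intro k hk x hx
    rcases (Nat.lt_succ_iff.1 hk).eq_or_lt with rfl | hk
    · have h1 : min x (X (l + 1)) = X (l + 1) := min_eq_right hx.1
      dsimp only
      rw [h1, hfm, Set.IccExtend_of_mem _ _ hx, Set.domRestrict_apply]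
      ring
    · have hxl : x ≤ X (l + 1) := hx.2.trans (hX' _ (by omega) _ (by omega))
      dsimp only
      rw [min_eq_left hxl, Set.IccExtend_of_le_left _ _ hxl, Set.domRestrict_apply, hfe k hk x hx]
      simp

/-- Two continuous functions that do not meet on an open interval keep their order there. -/
theorem lt_on_Ioo_of_ne {f g : ℝ → ℝ} {a b : ℝ} (hf : ContinuousOn f (Set.Ioo a b))
    (hg : ContinuousOn g (Set.Ioo a b)) (hne : ∀ x ∈ Set.Ioo a b, f x ≠ g x) {z : ℝ}
    (hz : z ∈ Set.Ioo a b) (hlt : f z < g z) : ∀ x ∈ Set.Ioo a b, f x < g x := by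
  intro x hx
  by_contra hcon
  obtain ⟨y, hy, he⟩ := isPreconnected_Ioo.intermediate_value₂ hz hx hf hg hlt.le (not_lt.1 hcon)
  exact hne y hy he

theorem le_on_Icc_of_lt_on_Ioo {f g : ℝ → ℝ} {a b : ℝ} (hab : a < b)
    (hf : ContinuousOn f (Set.Icc a b)) (hg : ContinuousOn g (Set.Icc a b))
    (hlt : ∀ x ∈ Set.Ioo a b, f x < g x) : ∀ x ∈ Set.Icc a b, f x ≤ g x := by
  intro x hx
  rw [← closure_Ioo hab.ne] at hf hg hx
  exact ContinuousWithinAt.closure_le hx ((hf x hx).mono subset_closure)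
    ((hg x hx).mono subset_closure) fun y hy => (hlt y hy).le

/-! ### Caterpillar trees with two rows of vertices -/

namespace Graph

variable {α β : Type*}

/-- The edges of `T` are `m 0, …, m (n - 1)`, and `m k` joins `A k` to `B k`; in each step from `k`
to `k + 1` one of the two ends stays, and the other one is replaced by a new vertex. -/
structure IsTwoRowCaterpillar (T : Graph α β) (A B : ℕ → α) (m : ℕ → β) (n : ℕ) : Prop where
  mem_vertexSet : ∀ F, F ∈ T.vertexSet ↔ ∃ k < n, F = A k ∨ F = B k
  isLink : ∀ e F F', T.IsLink e F F' ↔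
    ∃ k < n, e = m k ∧ ((F = A k ∧ F' = B k) ∨ (F = B k ∧ F' = A k))
  ne : ∀ j < n, ∀ k < n, A j ≠ B k
  step : ∀ k, k + 1 < n → (A (k + 1) = A k ∧ ∀ j ≤ k, B (k + 1) ≠ B j) ∨
    (B (k + 1) = B k ∧ ∀ j ≤ k, A (k + 1) ≠ A j)

namespace IsTwoRowCaterpillar

variable {T : Graph α β} {A B : ℕ → α} {m : ℕ → β} {n : ℕ}

theorem eq_of_eq_of_eq (h : IsTwoRowCaterpillar T A B m n) {j k : ℕ} (hj : j < n) (hk : k < n)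
    (hA : A j = A k) (hB : B j = B k) : j = k := by
  wlog hjk : j ≤ k generalizing j k
  · exact (this hk hj hA.symm hB.symm (by omega)).symm
  by_contra hne
  obtain ⟨i, rfl⟩ : ∃ i, k = i + 1 := ⟨k - 1, by omega⟩
  rcases h.step i hk with h' | h'
  · exact h'.2 j (by omega) hB.symm
  · exact h'.2 j (by omega) hA.symm

theorem ncard_vertexSet (h : IsTwoRowCaterpillar T A B m n) (hn : 0 < n) :
    T.vertexSet.Finite ∧ T.vertexSet.ncard = n + 1 := by
  have key : ∀ i < n, {F | ∃ k < i + 1, F = A k ∨ F = B k}.Finite ∧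
      {F | ∃ k < i + 1, F = A k ∨ F = B k}.ncard = i + 2 := by
    intro i
    induction i with
    | zero =>
      intro hi
      have : {F | ∃ k < 0 + 1, F = A k ∨ F = B k} = {A 0, B 0} := by
        ext F; simp
      rw [this, Set.ncard_pair (h.ne 0 hi 0 hi)]
      exact ⟨Set.toFinite _, rfl⟩
    | succ i ih =>
      intro hi
      obtain ⟨hfin, hcard⟩ := ih (by omega)
      have aux : ∀ F, (∀ k < i + 1, F ≠ A k ∧ F ≠ B k) →
          {F' | ∃ k < i + 1 + 1, F' = A k ∨ F' = B k} =
            insert F {F' | ∃ k < i + 1, F' = A k ∨ F' = B k} →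
          {F | ∃ k < i + 1 + 1, F = A k ∨ F = B k}.Finite ∧
            {F | ∃ k < i + 1 + 1, F = A k ∨ F = B k}.ncard = i + 1 + 2 := by
        intro F hF he
        rw [he, Set.ncard_insert_of_notMem _ hfin, hcard]
        · exact ⟨hfin.insert F, rfl⟩
        · rintro ⟨k, hk, h' | h'⟩
          · exact (hF k hk).1 h'
          · exact (hF k hk).2 h'
      rcases h.step i hi with ⟨h1, h2⟩ | ⟨h1, h2⟩
      · refine aux (B (i + 1)) (fun k hk => ⟨(h.ne k (by omega) _ hi).symm, h2 k (by omega)⟩) ?_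
        ext F
        simp only [Set.mem_ofPred_eq, Set.mem_insert_iff, Nat.lt_succ_iff_lt_or_eq (n := i + 1)]
        grind
      · refine aux (A (i + 1)) (fun k hk => ⟨h2 k (by omega), h.ne _ hi k (by omega)⟩) ?_
        ext F
        simp only [Set.mem_ofPred_eq, Set.mem_insert_iff, Nat.lt_succ_iff_lt_or_eq (n := i + 1)]
        grind
  obtain ⟨i, rfl⟩ : ∃ i, n = i + 1 := ⟨n - 1, by omega⟩
  have hV : T.vertexSet = {F | ∃ k < i + 1, F = A k ∨ F = B k} := Set.ext h.mem_vertexSet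
  rw [hV]
  exact key i i.lt_succ_self

theorem simple (h : IsTwoRowCaterpillar T A B m n) : T.Simple := by
  refine { not_isLoopAt := fun e F hF => ?_, eq_of_isLink := fun e e' F F' he he' => ?_ }
  · obtain ⟨k, hk, -, ⟨h1, h2⟩ | ⟨h1, h2⟩⟩ := (h.isLink e F F).1 hF
    · exact h.ne k hk k hk (h1.symm.trans h2)
    · exact h.ne k hk k hk (h2.symm.trans h1)
  · obtain ⟨j, hj, rfl, h1⟩ := (h.isLink _ _ _).1 he
    obtain ⟨k, hk, rfl, h2⟩ := (h.isLink _ _ _).1 he'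
    rcases h1 with ⟨rfl, rfl⟩ | ⟨rfl, rfl⟩ <;> rcases h2 with ⟨h2, h3⟩ | ⟨h2, h3⟩
    · rw [h.eq_of_eq_of_eq hj hk h2 h3]
    · exact absurd h2 (h.ne j hj k hk)
    · exact absurd h3 (h.ne j hj k hk)
    · rw [h.eq_of_eq_of_eq hj hk h3 h2]

theorem isMultigraphTree (h : IsTwoRowCaterpillar T A B m n) (hn : 0 < n) :
    T.IsMultigraphTree := by
  have hs := h.simple
  obtain ⟨hfin, hcard⟩ := h.ncard_vertexSet hn
  have hAm : ∀ k < n, A k ∈ T.vertexSet := fun k hk => (h.mem_vertexSet _).2 ⟨k, hk, Or.inl rfl⟩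
  have hBm : ∀ k < n, B k ∈ T.vertexSet := fun k hk => (h.mem_vertexSet _).2 ⟨k, hk, Or.inr rfl⟩
  have hadj : ∀ k (hk : k < n), T.toSimpleGraph.Adj ⟨A k, hAm k hk⟩ ⟨B k, hBm k hk⟩ := by
    intro k hk
    rw [toSimpleGraph_adj_iff]
    exact ⟨m k, (h.isLink _ _ _).2 ⟨k, hk, rfl, Or.inl ⟨rfl, rfl⟩⟩⟩
  have := hfin.to_subtype
  refine ⟨hs, SimpleGraph.isTree_iff_connected_and_card.2 ⟨?_, ?_⟩⟩
  · rw [SimpleGraph.connected_iff_exists_forall_reachable]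
    refine ⟨⟨A 0, hAm 0 hn⟩, ?_⟩
    have key : ∀ k (hk : k < n), T.toSimpleGraph.Reachable ⟨A 0, hAm 0 hn⟩ ⟨A k, hAm k hk⟩ ∧
        T.toSimpleGraph.Reachable ⟨A 0, hAm 0 hn⟩ ⟨B k, hBm k hk⟩ := by
      intro k
      induction k with
      | zero => exact fun hk => ⟨SimpleGraph.Reachable.refl _, (hadj 0 hk).reachable⟩
      | succ k ih =>
        intro hk
        obtain ⟨ihA, ihB⟩ := ih (by omega)
        rcases h.step k hk with ⟨h1, -⟩ | ⟨h1, -⟩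
        · have hA : T.toSimpleGraph.Reachable ⟨A 0, hAm 0 hn⟩ ⟨A (k + 1), hAm _ hk⟩ := by
            simpa only [h1] using ihA
          exact ⟨hA, hA.trans (hadj _ hk).reachable⟩
        · have hB : T.toSimpleGraph.Reachable ⟨A 0, hAm 0 hn⟩ ⟨B (k + 1), hBm _ hk⟩ := by
            simpa only [h1] using ihB
          exact ⟨hB.trans (hadj _ hk).symm.reachable, hB⟩
    rintro ⟨F, hF⟩
    obtain ⟨k, hk, rfl | rfl⟩ := (h.mem_vertexSet F).1 hF
    · exact (key k hk).1
    · exact (key k hk).2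
  · have hinj : Function.Injective
        fun k : Fin n => s((⟨A k, hAm k k.2⟩ : T.vertexSet), ⟨B k, hBm k k.2⟩) := by
      intro j k hjk
      simp only [Sym2.eq_iff, Subtype.mk.injEq] at hjk
      rcases hjk with ⟨h1, h2⟩ | ⟨h1, -⟩
      · exact Fin.ext (h.eq_of_eq_of_eq j.2 k.2 h1 h2)
      · exact absurd h1 (h.ne j j.2 k k.2)
    have hedge : T.toSimpleGraph.edgeSet = Set.range
        fun k : Fin n => s((⟨A k, hAm k k.2⟩ : T.vertexSet), ⟨B k, hBm k k.2⟩) := by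
      ext e
      induction e with
      | h F F' =>
        obtain ⟨F, hF⟩ := F
        obtain ⟨F', hF'⟩ := F'
        rw [SimpleGraph.mem_edgeSet, toSimpleGraph_adj_iff]
        constructor
        · rintro ⟨e, he⟩
          obtain ⟨k, hk, -, h'⟩ := (h.isLink _ _ _).1 he
          refine ⟨⟨k, hk⟩, ?_⟩
          simp only [Sym2.eq_iff, Subtype.mk.injEq]
          rcases h' with ⟨rfl, rfl⟩ | ⟨rfl, rfl⟩ <;> simp
        · rintro ⟨k, hk⟩
          simp only [Sym2.eq_iff, Subtype.mk.injEq] at hk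
          refine ⟨m k, (h.isLink _ _ _).2 ⟨k, k.2, rfl, ?_⟩⟩
          rcases hk with ⟨rfl, rfl⟩ | ⟨rfl, rfl⟩ <;> simp
    rw [hedge, Nat.card_range_of_injective hinj, Nat.card_fin, Nat.card_coe_set_eq, hcard]

end IsTwoRowCaterpillar

end Graph

/-- Two segments between the lines `y = 0` and `y = 1` whose ends are weakly ordered in the same way
meet only in common ends. -/
theorem mem_segment_inter_of_le {u u' v v' : ℝ} (hu : u ≤ u') (hv : v ≤ v') {q : ℝ × ℝ}
    (h : q ∈ segment ℝ ((u, 0) : ℝ × ℝ) (v, 1)) (h' : q ∈ segment ℝ ((u', 0) : ℝ × ℝ) (v', 1)) :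
    (q = (u, 0) ∧ u = u') ∨ (q = (v, 1) ∧ v = v') ∨ (u = u' ∧ v = v') := by
  obtain ⟨a, b, ha, hb, hab, rfl⟩ := h
  obtain ⟨a', b', -, -, hab', he⟩ := h'
  simp only [Prod.smul_mk, smul_eq_mul, mul_zero, mul_one, Prod.mk_add_mk, zero_add,
    Prod.mk.injEq] at he ⊢
  obtain ⟨he, rfl⟩ := he
  obtain rfl : a' = a := by linarith
  have h1 : a' * (u' - u) = 0 := by nlinarith [mul_nonneg ha (sub_nonneg.2 hu)]
  have h2 : b' * (v' - v) = 0 := by nlinarith [mul_nonneg hb (sub_nonneg.2 hv)]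
  rcases mul_eq_zero.1 h1 with rfl | h1
  · rcases mul_eq_zero.1 h2 with rfl | h2
    · norm_num at hab
    · obtain rfl : b' = 1 := by linarith
      exact Or.inr (Or.inl ⟨⟨by ring, rfl⟩, by linarith⟩)
  · rcases mul_eq_zero.1 h2 with rfl | h2
    · obtain rfl : a' = 1 := by linarith
      exact Or.inl ⟨⟨by ring, rfl⟩, by linarith⟩
    · exact Or.inr (Or.inr ⟨by linarith, by linarith⟩)

theorem Graph.IsTwoRowCaterpillar.isBipartiteNoncrossing {α β : Type*} {T : Graph α β}
    {A B : ℕ → α} {m : ℕ → β} {n : ℕ} (h : T.IsTwoRowCaterpillar A B m n) {x rank : α → ℝ}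
    (hA : ∀ k < n, rank (A k) = 0) (hB : ∀ k < n, rank (B k) = 1)
    (hxA : ∀ j k, j ≤ k → k < n → A j = A k ∨ x (A j) < x (A k))
    (hxB : ∀ j k, j ≤ k → k < n → B j = B k ∨ x (B j) < x (B k)) :
    T.IsBipartiteNoncrossing fun F => (x F, rank F) := by
  have hA' : ∀ j < n, ∀ k < n, x (A j) = x (A k) → A j = A k := by
    intro j hj k hk he
    rcases le_total j k with hjk | hjk
    · exact (hxA j k hjk hk).resolve_right he.not_lt
    · exact ((hxA k j hjk hj).resolve_right he.symm.not_lt).symm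
  have hB' : ∀ j < n, ∀ k < n, x (B j) = x (B k) → B j = B k := by
    intro j hj k hk he
    rcases le_total j k with hjk | hjk
    · exact (hxB j k hjk hk).resolve_right he.not_lt
    · exact ((hxB k j hjk hj).resolve_right he.symm.not_lt).symm
  have hcross : ∀ j < n, ∀ k < n, j ≠ k →
      segment ℝ (x (A j), rank (A j)) (x (B j), rank (B j)) ∩
        segment ℝ (x (A k), rank (A k)) (x (B k), rank (B k)) ⊆
      (fun F => (x F, rank F)) '' ({A j, B j} ∩ {A k, B k}) := by
    intro j hj k hk hjk
    wlog hlt : j < k generalizing j k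
    · rw [Set.inter_comm, Set.inter_comm {A j, B j}]
      exact this k hk j hj hjk.symm (by omega)
    rw [hA j hj, hA k hk, hB j hj, hB k hk]
    rintro q ⟨hq, hq'⟩
    have hxA' : x (A j) ≤ x (A k) := (hxA j k hlt.le hk).elim (fun he => he ▸ le_rfl) le_of_lt
    have hxB' : x (B j) ≤ x (B k) := (hxB j k hlt.le hk).elim (fun he => he ▸ le_rfl) le_of_lt
    rcases mem_segment_inter_of_le hxA' hxB' hq hq' with ⟨rfl, he⟩ | ⟨rfl, he⟩ | ⟨h1, h2⟩
    · exact ⟨A j, ⟨Or.inl rfl, Or.inl (hA' j hj k hk he)⟩, by simp [hA j hj]⟩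
    · exact ⟨B j, ⟨Or.inr rfl, Or.inr (hB' j hj k hk he)⟩, by simp [hB j hj]⟩
    · exact absurd (h.eq_of_eq_of_eq hj hk (hA' j hj k hk h1) (hB' j hj k hk h2)) hjk
  refine ⟨?_, ?_, ?_, ?_⟩
  · intro F hF F' hF' he
    obtain ⟨hx, hr⟩ := Prod.mk.inj he
    obtain ⟨j, hj, rfl | rfl⟩ := (h.mem_vertexSet F).1 hF <;>
      obtain ⟨k, hk, rfl | rfl⟩ := (h.mem_vertexSet F').1 hF'
    · exact hA' j hj k hk hx
    · rw [hA j hj, hB k hk] at hr; norm_num at hr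
    · rw [hB j hj, hA k hk] at hr; norm_num at hr
    · exact hB' j hj k hk hx
  · intro F hF
    obtain ⟨k, hk, rfl | rfl⟩ := (h.mem_vertexSet F).1 hF
    · exact Or.inl (hA k hk)
    · exact Or.inr (hB k hk)
  · intro e F F' he
    obtain ⟨k, hk, -, ⟨rfl, rfl⟩ | ⟨rfl, rfl⟩⟩ := (h.isLink _ _ _).1 he <;>
      simp [hA k hk, hB k hk]
  · intro e e' u v u' v' he he' hne
    obtain ⟨j, hj, rfl, h1⟩ := (h.isLink _ _ _).1 he
    obtain ⟨k, hk, rfl, h2⟩ := (h.isLink _ _ _).1 he'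
    have hc := hcross j hj k hk fun hjk => hne (by rw [hjk])
    rcases h1 with ⟨rfl, rfl⟩ | ⟨rfl, rfl⟩ <;> rcases h2 with ⟨rfl, rfl⟩ | ⟨rfl, rfl⟩
    · exact hc
    · rwa [segment_symm ℝ (_, rank (B k)), Set.pair_comm (B k)]
    · rwa [segment_symm ℝ (_, rank (B j)), Set.pair_comm (B j)]
    · rwa [segment_symm ℝ (_, rank (B j)), Set.pair_comm (B j), segment_symm ℝ (_, rank (B k)),
        Set.pair_comm (B k)]

/-! ### Cuts of a full DAG -/

namespace OrderedDAG

variable {n : ℕ} {E : Type*}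

/-- The edges that pass from `{0, …, k}` to `{k + 1, …, n}`. -/
def cut (G : OrderedDAG n E) (k : ℕ) : Set E := {e | (G.src e : ℕ) ≤ k ∧ k < (G.tgt e : ℕ)}

variable {G : OrderedDAG n E}

theorem ncard_out (k : ℕ) (hk : k ≤ n) :
    {e | (G.src e : ℕ) = k}.ncard = G.outDegree ⟨k, Nat.lt_succ_of_le hk⟩ := by
  rw [outDegree, ← Nat.card_coe_set_eq]
  simp only [Fin.ext_iff]
  rfl

theorem ncard_in (k : ℕ) (hk : k ≤ n) :
    {e | (G.tgt e : ℕ) = k}.ncard = G.inDegree ⟨k, Nat.lt_succ_of_le hk⟩ := by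
  rw [inDegree, ← Nat.card_coe_set_eq]
  simp only [Fin.ext_iff]
  rfl

theorem out_subset_cut (k : ℕ) : {e | (G.src e : ℕ) = k} ⊆ G.cut k := by
  rintro e rfl
  exact ⟨le_rfl, G.src_lt_tgt e⟩

theorem in_subset_cut (k : ℕ) : {e | (G.tgt e : ℕ) = k + 1} ⊆ G.cut k := by
  intro e he
  have h1 : (G.tgt e : ℕ) = k + 1 := he
  have h2 : (G.src e : ℕ) < G.tgt e := G.src_lt_tgt e
  exact ⟨by omega, by omega⟩

theorem cut_succ (k : ℕ) :
    G.cut (k + 1) = (G.cut k \ {e | (G.tgt e : ℕ) = k + 1}) ∪ {e | (G.src e : ℕ) = k + 1} := by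
  ext e
  have h2 : (G.src e : ℕ) < G.tgt e := G.src_lt_tgt e
  simp only [cut, Set.mem_union, Set.mem_sdiff, Set.mem_ofPred_eq]
  omega

namespace IsFull

theorem pos {d : ℕ} (hG : G.IsFull (d + 1)) : 0 < n := by
  rcases Nat.eq_zero_or_pos n with rfl | h
  · have h1 := hG.out_source
    have h2 := hG.out_sink
    rw [show Fin.last 0 = 0 from rfl] at h2
    omega
  · exact h

theorem ncard_out_inner {d k : ℕ} (hG : G.IsFull d) (hk : k + 1 < n) :
    {e | (G.src e : ℕ) = k + 1}.ncard = 2 := by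
  rw [ncard_out _ hk.le]
  exact hG.out_inner _ (by simp [Fin.ext_iff]) (by simp [Fin.ext_iff]; omega)

theorem ncard_in_inner {d k : ℕ} (hG : G.IsFull d) (hk : k + 1 < n) :
    {e | (G.tgt e : ℕ) = k + 1}.ncard = 2 := by
  rw [ncard_in _ hk.le]
  exact hG.in_inner _ (by simp [Fin.ext_iff]) (by simp [Fin.ext_iff]; omega)

theorem ncard_cut [Finite E] {d k : ℕ} (hG : G.IsFull d) (hk : k < n) : (G.cut k).ncard = d := by
  induction k with
  | zero =>
    have : G.cut 0 = {e | (G.src e : ℕ) = 0} := by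
      refine Set.Subset.antisymm (fun e he => Nat.le_zero.1 he.1) (out_subset_cut 0)
    rw [this, ncard_out 0 hk.le]
    exact hG.out_source
  | succ k ih =>
    have h2 : (G.cut k \ {e | (G.tgt e : ℕ) = k + 1}).ncard + 2 = d := by
      rw [← hG.ncard_in_inner hk, Set.ncard_sdiff_add_ncard_of_subset (in_subset_cut k),
        ih (by omega)]
    rw [cut_succ, Set.ncard_union_eq, hG.ncard_out_inner hk, h2]
    rw [Set.disjoint_left]
    rintro e ⟨he, -⟩ he'
    have h3 : (G.src e : ℕ) = k + 1 := he'
    have h4 : (G.src e : ℕ) ≤ k := he.1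
    omega

/-- Consecutive vertices are joined by an edge: among the three edges of a cut there are at least
two that start at the vertex before it and at least two that end at the vertex after it. -/
theorem exists_short_edge [Finite E] {k : ℕ} (hG : G.IsFull 3) (hk : k < n) :
    ∃ e, (G.src e : ℕ) = k ∧ (G.tgt e : ℕ) = k + 1 := by
  have hout : 2 ≤ {e | (G.src e : ℕ) = k}.ncard := by
    rcases Nat.eq_zero_or_pos k with rfl | h0
    · rw [ncard_out _ hk.le]
      exact hG.out_source.symm.le.trans' (by norm_num)
    · obtain ⟨j, rfl⟩ : ∃ j, k = j + 1 := ⟨k - 1, by omega⟩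
      exact (hG.ncard_out_inner hk).symm.le
  have hin : 2 ≤ {e | (G.tgt e : ℕ) = k + 1}.ncard := by
    rcases Nat.lt_or_ge (k + 1) n with h | h
    · exact (hG.ncard_in_inner h).symm.le
    · obtain rfl : n = k + 1 := by omega
      rw [ncard_in _ le_rfl]
      exact hG.in_sink.symm.le.trans' (by norm_num)
  by_contra! hcon
  have hd : Disjoint {e | (G.src e : ℕ) = k} {e | (G.tgt e : ℕ) = k + 1} :=
    Set.disjoint_left.2 fun e he he' => hcon e he he'
  have h4 := Set.ncard_union_eq hd
  have h3 := Set.ncard_le_ncard (Set.union_subset (out_subset_cut (G := G) k) (in_subset_cut k))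
  rw [hG.ncard_cut hk] at h3
  omega

/-- Exactly one of the three edges of a cut passes by an inner vertex. -/
theorem exists_passing_edge [Finite E] {k : ℕ} (hG : G.IsFull 3) (hk : k + 1 < n) :
    ∃ p, p ∈ G.cut k ∧ p ∈ G.cut (k + 1) ∧ (∀ e ∈ G.cut k, e ≠ p → (G.tgt e : ℕ) = k + 1) ∧
      ∀ e ∈ G.cut (k + 1), e ≠ p → (G.src e : ℕ) = k + 1 := by
  have h1 : (G.cut k \ {e | (G.tgt e : ℕ) = k + 1}).ncard = 1 := by
    have := Set.ncard_sdiff_add_ncard_of_subset (in_subset_cut (G := G) k)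
    rw [hG.ncard_in_inner hk, hG.ncard_cut (by omega)] at this
    omega
  obtain ⟨p, hp⟩ := Set.ncard_eq_one.1 h1
  have hp' : p ∈ G.cut k \ {e | (G.tgt e : ℕ) = k + 1} := hp ▸ rfl
  refine ⟨p, hp'.1, ?_, fun e he hne => ?_, fun e he hne => ?_⟩
  · rw [cut_succ]
    exact Or.inl hp'
  · by_contra hcon
    exact hne (by simpa using hp.subset ⟨he, hcon⟩)
  · rw [cut_succ, hp] at he
    exact he.resolve_left hne

/-! ### Existence of a strongly planar realization -/

/-- The edges of a full DAG fall into three paths from the source to the sink, one of which runs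
through all vertices. The middle path has colour `0`, the other two have colours `1` and `-1`:
at every inner vertex the edge that starts there and is not on the middle path takes the
colour of the one that ends there. -/
theorem exists_coloring [Finite E] (hG : G.IsFull 3) :
    ∃ c : E → ℤ, (∀ e, c e = 0 ∨ c e = 1 ∨ c e = -1) ∧
      (∀ e, c e = 0 → (G.tgt e : ℕ) = G.src e + 1) ∧ ∀ k < n, Set.InjOn c (G.cut k) := by
  classical
  suffices H : ∀ k < n, ∃ c : E → ℤ, (∀ e, (G.src e : ℕ) ≤ k → c e = 0 ∨ c e = 1 ∨ c e = -1) ∧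
      (∀ e, (G.src e : ℕ) ≤ k → c e = 0 → (G.tgt e : ℕ) = G.src e + 1) ∧
      ∀ j ≤ k, Set.InjOn c (G.cut j) by
    have hn := hG.pos
    obtain ⟨c, h1, h2, h3⟩ := H (n - 1) (by omega)
    have hsrc : ∀ e, (G.src e : ℕ) ≤ n - 1 := fun e => by
      have h4 : (G.src e : ℕ) < G.tgt e := G.src_lt_tgt e
      have h5 := (G.tgt e).2
      omega
    exact ⟨c, fun e => h1 e (hsrc e), fun e => h2 e (hsrc e), fun k hk => h3 k (by omega)⟩
  -- it suffices to extend a colouring to the two new edges of a cut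
  have key : ∀ k < n, ∀ (c : E → ℤ) (p m q : E), G.cut k = {p, m, q} → p ≠ m → p ≠ q → m ≠ q →
      (∀ e, (G.src e : ℕ) ≤ k → e = m ∨ e = q ∨ c e = 0 ∨ c e = 1 ∨ c e = -1) →
      (∀ e, (G.src e : ℕ) ≤ k → e = m ∨ e = q ∨ (c e = 0 → (G.tgt e : ℕ) = G.src e + 1)) →
      (∀ j < k, Set.InjOn c (G.cut j)) → (∀ j < k, m ∉ G.cut j ∧ q ∉ G.cut j) →
      (G.tgt m : ℕ) = G.src m + 1 → (c p = 1 ∨ c p = -1) →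
      ∃ c : E → ℤ, (∀ e, (G.src e : ℕ) ≤ k → c e = 0 ∨ c e = 1 ∨ c e = -1) ∧
        (∀ e, (G.src e : ℕ) ≤ k → c e = 0 → (G.tgt e : ℕ) = G.src e + 1) ∧
        ∀ j ≤ k, Set.InjOn c (G.cut j) := by
    intro k hk c p m q hcut hpm hpq hmq h1 h2 h3 h4 hm hp
    refine ⟨fun e => if e = m then 0 else if e = q then - c p else c e, ?_, ?_, ?_⟩
    · intro e he
      have := h1 e he
      dsimp only
      split_ifs <;> grind
    · intro e he
      have := h2 e he
      dsimp only
      split_ifs <;> grind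
    · intro j hj
      rcases hj.eq_or_lt with rfl | hj
      · rw [hcut]
        intro e he e' he' hee
        simp only [Set.mem_insert_iff, Set.mem_singleton_iff] at he he'
        dsimp only at hee
        grind
      · refine (h3 j hj).congr fun e he => ?_
        have hem : e ≠ m := fun h => (h4 j hj).1 (h ▸ he)
        have heq : e ≠ q := fun h => (h4 j hj).2 (h ▸ he)
        simp [hem, heq]
  intro k
  induction k with
  | zero =>
    intro hk
    obtain ⟨m, hm1, hm2⟩ := hG.exists_short_edge hk
    have hmc : m ∈ G.cut 0 := out_subset_cut 0 hm1
    have hcard : (G.cut 0 \ {m}).ncard = 2 := by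
      rw [Set.ncard_sdiff_singleton_of_mem hmc, hG.ncard_cut hk]
    obtain ⟨p, q, hpq, hs⟩ := Set.ncard_eq_two.1 hcard
    have hp : p ∈ G.cut 0 \ {m} := hs ▸ Or.inl rfl
    have hq : q ∈ G.cut 0 \ {m} := hs ▸ Or.inr rfl
    refine key 0 hk (fun _ => 1) p m q ?_ hp.2 hpq (fun h => hq.2 h.symm) (by simp) (by simp)
      (by simp) (by simp) (by omega) (by simp)
    rw [← Set.insert_sdiff_self_of_mem hmc, hs, Set.insert_comm]
  | succ k ih =>
    intro hk
    obtain ⟨c, h1, h2, h3⟩ := ih (by omega)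
    obtain ⟨m, hm1, hm2⟩ := hG.exists_short_edge hk
    obtain ⟨p, hp1, hp2, -, hp4⟩ := hG.exists_passing_edge hk
    have hout : {e | (G.src e : ℕ) = k + 1} = G.cut (k + 1) \ {p} := by
      ext e
      refine ⟨fun he => ⟨out_subset_cut _ he, ?_⟩, fun he => hp4 e he.1 he.2⟩
      rintro rfl
      have h4 : (G.src e : ℕ) = k + 1 := he
      have h5 : (G.src e : ℕ) ≤ k := hp1.1
      omega
    obtain ⟨a, b, hab, hs⟩ := Set.ncard_eq_two.1 (hG.ncard_out_inner hk)
    obtain ⟨q, hmq, hs⟩ : ∃ q, m ≠ q ∧ {e | (G.src e : ℕ) = k + 1} = {m, q} := by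
      have hm' : m ∈ ({a, b} : Set E) := hs ▸ hm1
      rcases hm' with rfl | rfl
      · exact ⟨b, hab, hs⟩
      · exact ⟨a, hab.symm, hs.trans (Set.pair_comm _ _)⟩
    have hq1 : (G.src q : ℕ) = k + 1 := by
      have : q ∈ {e | (G.src e : ℕ) = k + 1} := hs ▸ Or.inr rfl
      exact this
    have hpk : (G.src p : ℕ) ≤ k := hp1.1
    have hpk' : k + 1 < (G.tgt p : ℕ) := hp2.2
    have hnew : ∀ e, (G.src e : ℕ) ≤ k + 1 → e ≠ m → e ≠ q → (G.src e : ℕ) ≤ k := by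
      intro e he hem heq
      by_contra hcon
      have : e ∈ {e | (G.src e : ℕ) = k + 1} := by
        show (G.src e : ℕ) = k + 1
        omega
      rw [hs] at this
      exact this.elim hem heq
    refine key (k + 1) hk c p m q ?_ ?_ ?_ hmq ?_ ?_ ?_ ?_ (by omega) ?_
    · rw [← Set.insert_sdiff_self_of_mem hp2, ← hout, hs]
    · rintro rfl; omega
    · rintro rfl; omega
    · intro e he
      by_cases hem : e = m
      · exact Or.inl hem
      by_cases heq : e = q
      · exact Or.inr (Or.inl heq)
      exact Or.inr (Or.inr (h1 e (hnew e he hem heq)))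
    · intro e he
      by_cases hem : e = m
      · exact Or.inl hem
      by_cases heq : e = q
      · exact Or.inr (Or.inl heq)
      exact Or.inr (Or.inr (h2 e (hnew e he hem heq)))
    · exact fun j hj => h3 j (by omega)
    · refine fun j hj => ⟨fun h => ?_, fun h => ?_⟩
      · have : (G.src m : ℕ) ≤ j := h.1
        omega
      · have : (G.src q : ℕ) ≤ j := h.1
        omega
    · -- the passing edge is not short
      have := h1 p hpk
      have := h2 p hpk
      omega

/-- The vertices are placed on the `x`-axis; the middle path runs along the axis, the other
two paths are drawn by parabolic arcs above and below it. -/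
theorem nonempty_realization [Finite E] (hG : G.IsFull 3) :
    Nonempty (StronglyPlanarRealization G) := by
  obtain ⟨c, hc, hshort, hinj⟩ := hG.exists_coloring
  have hlt : ∀ e, ((G.src e : ℕ) : ℝ) < ((G.tgt e : ℕ) : ℝ) := fun e =>
    Nat.cast_lt.2 (G.src_lt_tgt e)
  -- edges of one colour do not overlap
  have hsep : ∀ e e', e ≠ e' → c e = c e' →
      (G.tgt e : ℕ) ≤ G.src e' ∨ (G.tgt e' : ℕ) ≤ G.src e := by
    intro e e' hne hce
    by_contra! hcon
    have h1 : (G.src e : ℕ) < G.tgt e := G.src_lt_tgt e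
    have h2 : (G.src e' : ℕ) < G.tgt e' := G.src_lt_tgt e'
    have h3 := (G.tgt e).2
    have h4 := (G.tgt e').2
    exact hne (hinj (max (G.src e : ℕ) (G.src e')) (by omega)
      ⟨by omega, by omega⟩ ⟨by omega, by omega⟩ hce)
  have hzero : ∀ (e : E) (x : ℝ), c e * ((x - (G.src e : ℕ)) * ((G.tgt e : ℕ) - x)) = 0 →
      c e = 0 ∨ x = (G.src e : ℕ) ∨ x = (G.tgt e : ℕ) := by
    intro e x h
    rcases mul_eq_zero.1 h with h | h
    · exact Or.inl (by exact_mod_cast h)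
    · rcases mul_eq_zero.1 h with h | h
      · exact Or.inr (Or.inl (by linarith))
      · exact Or.inr (Or.inr (by linarith))
  -- a point of integral abscissa on the middle path is a vertex
  have hint : ∀ (e : E) (v : ℕ), c e = 0 → (v : ℝ) ∈ Set.Icc ((G.src e : ℕ) : ℝ) (G.tgt e : ℕ) →
      v = (G.src e : ℕ) ∨ v = (G.tgt e : ℕ) := by
    intro e v he hv
    have h1 := hshort e he
    have h2 : (G.src e : ℕ) ≤ v := by exact_mod_cast hv.1
    have h3 : v ≤ (G.tgt e : ℕ) := by exact_mod_cast hv.2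
    omega
  have hmeet : ∀ e e', e ≠ e' → ∀ x : ℝ, x ∈ Set.Icc ((G.src e : ℕ) : ℝ) (G.tgt e : ℕ) →
      x ∈ Set.Icc ((G.src e' : ℕ) : ℝ) (G.tgt e' : ℕ) →
      c e * ((x - (G.src e : ℕ)) * ((G.tgt e : ℕ) - x)) =
        c e' * ((x - (G.src e' : ℕ)) * ((G.tgt e' : ℕ) - x)) →
      ∃ v : ℕ, x = v ∧ (v = (G.src e : ℕ) ∨ v = (G.tgt e : ℕ)) ∧
        (v = (G.src e' : ℕ) ∨ v = (G.tgt e' : ℕ)) := by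
    intro e e' hne x hx hx' heq
    have hu := mul_nonneg (sub_nonneg.2 hx.1) (sub_nonneg.2 hx.2)
    have hu' := mul_nonneg (sub_nonneg.2 hx'.1) (sub_nonneg.2 hx'.2)
    by_cases hce : c e = c e'
    · rcases hsep e e' hne hce with h | h
      · have h' : ((G.tgt e : ℕ) : ℝ) ≤ (G.src e' : ℕ) := Nat.cast_le.2 h
        have h1 : x = (G.tgt e : ℕ) := le_antisymm hx.2 (h'.trans hx'.1)
        have h2 : x = (G.src e' : ℕ) := le_antisymm (hx.2.trans h') hx'.1
        exact ⟨_, h1, Or.inr rfl, Or.inl (by rw [h1] at h2; exact_mod_cast h2)⟩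
      · have h' : ((G.tgt e' : ℕ) : ℝ) ≤ (G.src e : ℕ) := Nat.cast_le.2 h
        have h1 : x = (G.tgt e' : ℕ) := le_antisymm hx'.2 (h'.trans hx.1)
        have h2 : x = (G.src e : ℕ) := le_antisymm (hx'.2.trans h') hx.1
        exact ⟨_, h1, Or.inl (by rw [h1] at h2; exact_mod_cast h2), Or.inr rfl⟩
    -- two different colours: both values vanish, since their signs differ
    · have hboth : (c e : ℝ) * ((x - (G.src e : ℕ)) * ((G.tgt e : ℕ) - x)) = 0 ∧
          (c e' : ℝ) * ((x - (G.src e' : ℕ)) * ((G.tgt e' : ℕ) - x)) = 0 := by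
        rcases hc e with h | h | h <;> rcases hc e' with h' | h' | h' <;> rw [h, h'] at heq ⊢ <;>
          first
          | exact absurd (h.trans h'.symm) hce
          | (push_cast at heq ⊢; constructor <;> linarith)
      have hcast : ∀ {a b : ℕ}, x = (a : ℝ) → x = (b : ℝ) → a = b := fun h1 h2 => by
        rw [h1] at h2; exact_mod_cast h2
      rcases hzero e x hboth.1 with h0 | h
      · rcases hzero e' x hboth.2 with h0' | h' | h'
        · exact absurd (h0.trans h0'.symm) hce
        · exact ⟨_, h', hint e _ h0 (h' ▸ hx), Or.inl rfl⟩
        · exact ⟨_, h', hint e _ h0 (h' ▸ hx), Or.inr rfl⟩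
      · obtain ⟨v, hv, hv'⟩ : ∃ v : ℕ, x = v ∧ (v = (G.src e : ℕ) ∨ v = (G.tgt e : ℕ)) :=
          h.elim (fun h => ⟨_, h, Or.inl rfl⟩) fun h => ⟨_, h, Or.inr rfl⟩
        refine ⟨v, hv, hv', ?_⟩
        rcases hzero e' x hboth.2 with h0' | h' | h'
        · exact hint e' v h0' (hv ▸ hx')
        · exact Or.inl (hcast hv h')
        · exact Or.inr (hcast hv h')
  refine ⟨{
    pos := fun v => (((v : ℕ) : ℝ), 0)
    curve := fun e x => c e * ((x - (G.src e : ℕ)) * ((G.tgt e : ℕ) - x))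
    pos_injective := fun v w h => Fin.ext (by exact_mod_cast (Prod.mk.inj h).1)
    left_to_right := hlt
    curve_src := fun e => by simp
    curve_tgt := fun e => by simp
    curve_piecewise := fun e => ⟨Continuous.continuousOn (by fun_prop),
      ∅, Set.finite_empty, fun x _ => by fun_prop⟩
    vertex_on_edge := ?_
    edges_meet := ?_ }⟩
  · intro v e hv h
    have : (v : ℕ) = (G.src e : ℕ) ∨ (v : ℕ) = (G.tgt e : ℕ) := by
      rcases hzero e _ h with h0 | h | h
      · exact hint e v h0 hv
      · exact Or.inl (Nat.cast_injective h)
      · exact Or.inr (Nat.cast_injective h)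
    exact this.imp Fin.ext Fin.ext
  · intro e e' hne x hx hx' h
    obtain ⟨v, rfl, hv, hv'⟩ := hmeet e e' hne x hx hx' h
    have hvn : v < n + 1 := by
      rcases hv with rfl | rfl
      · exact (G.src e).2
      · exact (G.tgt e).2
    refine ⟨⟨v, hvn⟩, ⟨hv.imp Fin.ext Fin.ext, hv'.imp Fin.ext Fin.ext⟩, Prod.ext rfl ?_⟩
    rcases hv with rfl | rfl <;> simp

end IsFull

end OrderedDAG

/-! ### The three strands of a strongly planar realization -/

namespace StronglyPlanarRealization

variable {n : ℕ} {E : Type*} {G : OrderedDAG n E} (R : StronglyPlanarRealization G)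

/-- The abscissa of the vertex `k`, for a natural number `k ≤ n`. -/
def abscissa (k : ℕ) : ℝ := (R.pos (Fin.ofNat (n + 1) k)).1

/-- The ordinate of the vertex `k`, for a natural number `k ≤ n`. -/
def ordinate (k : ℕ) : ℝ := (R.pos (Fin.ofNat (n + 1) k)).2

theorem abscissa_val (v : Fin (n + 1)) : R.abscissa v = (R.pos v).1 := by
  simp [abscissa]

theorem ordinate_val (v : Fin (n + 1)) : R.ordinate v = (R.pos v).2 := by
  simp [ordinate]

variable {R}

/-- Consecutive vertices are joined by an edge, so the vertices appear from left to right in their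
given order. -/
theorem abscissa_lt_succ [Finite E] (hG : G.IsFull 3) {k : ℕ} (hk : k < n) :
    R.abscissa k < R.abscissa (k + 1) := by
  obtain ⟨e, h1, h2⟩ := hG.exists_short_edge hk
  rw [← h2, ← h1, abscissa_val, abscissa_val]
  exact R.left_to_right e

theorem abscissa_lt [Finite E] (hG : G.IsFull 3) {i j : ℕ} (hij : i < j) (hj : j ≤ n) :
    R.abscissa i < R.abscissa j := by
  induction j, hij using Nat.le_induction with
  | base => exact abscissa_lt_succ hG hj
  | succ j hij ih => exact (ih (by omega)).trans (abscissa_lt_succ hG hj)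

theorem abscissa_le [Finite E] (hG : G.IsFull 3) {i j : ℕ} (hij : i ≤ j) (hj : j ≤ n) :
    R.abscissa i ≤ R.abscissa j := by
  rcases hij.eq_or_lt with rfl | hij
  · exact le_rfl
  · exact (abscissa_lt hG hij hj).le

theorem Icc_subset_of_mem_cut [Finite E] (hG : G.IsFull 3) {k : ℕ} {e : E} (he : e ∈ G.cut k) :
    Set.Icc (R.abscissa k) (R.abscissa (k + 1)) ⊆
      Set.Icc (R.pos (G.src e)).1 (R.pos (G.tgt e)).1 := by
  have h := (G.tgt e).2
  have h1 : (G.src e : ℕ) ≤ k := he.1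
  have h2 : k < (G.tgt e : ℕ) := he.2
  rw [← abscissa_val, ← abscissa_val]
  exact Set.Icc_subset_Icc (abscissa_le hG h1 (by omega)) (abscissa_le hG h2 (by omega))

theorem continuousOn_curve [Finite E] (hG : G.IsFull 3) {k : ℕ} {e : E} (he : e ∈ G.cut k) :
    ContinuousOn (R.curve e) (Set.Icc (R.abscissa k) (R.abscissa (k + 1))) :=
  (R.curve_piecewise e).1.mono (Icc_subset_of_mem_cut hG he)

theorem curve_ne_curve [Finite E] (hG : G.IsFull 3) {k : ℕ} (hk : k < n) {e e' : E}
    (he : e ∈ G.cut k) (he' : e' ∈ G.cut k) (hne : e ≠ e') :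
    ∀ x ∈ Set.Ioo (R.abscissa k) (R.abscissa (k + 1)), R.curve e x ≠ R.curve e' x := by
  intro x hx heq
  have hx' := Set.Ioo_subset_Icc_self hx
  obtain ⟨v, -, hv⟩ := R.edges_meet e e' hne x (Icc_subset_of_mem_cut hG he hx')
    (Icc_subset_of_mem_cut hG he' hx') heq
  have hvx : R.abscissa v = x := by rw [abscissa_val, hv]
  have hvn := v.2
  rcases le_or_gt (v : ℕ) k with h | h
  · exact (hx.1.trans_le hvx.ge).not_ge (abscissa_le hG h hk.le)
  · exact (hvx.le.trans_lt hx.2).not_ge (abscissa_le hG h (by omega))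

theorem curve_eq_of_src {e : E} {k : ℕ} (h : (G.src e : ℕ) = k) :
    R.curve e (R.abscissa k) = R.ordinate k := by
  rw [← h, abscissa_val, ordinate_val, R.curve_src]

theorem curve_eq_of_tgt {e : E} {k : ℕ} (h : (G.tgt e : ℕ) = k) :
    R.curve e (R.abscissa k) = R.ordinate k := by
  rw [← h, abscissa_val, ordinate_val, R.curve_tgt]

/-- An edge that passes by a vertex does not run through it. -/
theorem curve_ne_ordinate [Finite E] (hG : G.IsFull 3) {k : ℕ} {e : E} (h1 : (G.src e : ℕ) < k)
    (h2 : k < (G.tgt e : ℕ)) : R.curve e (R.abscissa k) ≠ R.ordinate k := by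
  intro h
  have ht := (G.tgt e).2
  obtain ⟨v, rfl⟩ : ∃ v : Fin (n + 1), (v : ℕ) = k := ⟨⟨k, by omega⟩, rfl⟩
  have hmem := R.vertex_on_edge v e (by
    rw [← abscissa_val, ← abscissa_val, ← abscissa_val]
    exact ⟨abscissa_le hG h1.le (by omega), abscissa_le hG h2.le (by omega)⟩)
    (by rwa [abscissa_val, ordinate_val] at h)
  rcases hmem with rfl | rfl <;> omega

variable (R)

/-- The edges over `(X k, X (k + 1))` are, from bottom to top, `a`, `b` and `c`. -/
structure IsSortedCut (k : ℕ) (a b c : E) : Prop where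
  cut_eq : G.cut k = {a, b, c}
  lower_lt : ∀ x ∈ Set.Ioo (R.abscissa k) (R.abscissa (k + 1)), R.curve a x < R.curve b x
  lt_upper : ∀ x ∈ Set.Ioo (R.abscissa k) (R.abscissa (k + 1)), R.curve b x < R.curve c x

variable {R}

theorem exists_isSortedCut [Finite E] (hG : G.IsFull 3) {k : ℕ} (hk : k < n) :
    ∃ a b c, R.IsSortedCut k a b c := by
  obtain ⟨z, hz⟩ := Set.nonempty_Ioo.2 (abscissa_lt_succ (R := R) hG hk)
  have hsort : ∃ a b c, G.cut k = {a, b, c} ∧ R.curve a z < R.curve b z ∧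
      R.curve b z < R.curve c z := by
    obtain ⟨e, f, g, hef, heg, hfg, hs⟩ := Set.ncard_eq_three.1 (hG.ncard_cut hk)
    have he : e ∈ G.cut k := by simp [hs]
    have hf : f ∈ G.cut k := by simp [hs]
    have hg : g ∈ G.cut k := by simp [hs]
    rcases (curve_ne_curve hG hk he hf hef z hz).lt_or_gt with h1 | h1 <;>
    rcases (curve_ne_curve hG hk he hg heg z hz).lt_or_gt with h2 | h2 <;>
    rcases (curve_ne_curve hG hk hf hg hfg z hz).lt_or_gt with h3 | h3
    · exact ⟨e, f, g, hs, h1, h3⟩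
    · exact ⟨e, g, f, by rw [hs]; grind, h2, h3⟩
    · exact absurd h2 (h1.trans h3).not_gt
    · exact ⟨g, e, f, by rw [hs]; grind, h2, h1⟩
    · exact ⟨f, e, g, by rw [hs]; grind, h1, h2⟩
    · exact absurd h2 (h3.trans h1).not_gt
    · exact ⟨f, g, e, by rw [hs]; grind, h3, h2⟩
    · exact ⟨g, f, e, by rw [hs]; grind, h3, h1⟩
  obtain ⟨a, b, c, hs, h1, h2⟩ := hsort
  have hcont : ∀ e ∈ G.cut k,
      ContinuousOn (R.curve e) (Set.Ioo (R.abscissa k) (R.abscissa (k + 1))) :=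
    fun e he => (continuousOn_curve hG he).mono Set.Ioo_subset_Icc_self
  have key : ∀ e ∈ G.cut k, ∀ e' ∈ G.cut k, R.curve e z < R.curve e' z →
      ∀ x ∈ Set.Ioo (R.abscissa k) (R.abscissa (k + 1)), R.curve e x < R.curve e' x := by
    intro e he e' he' hlt
    refine lt_on_Ioo_of_ne (hcont e he) (hcont e' he') (curve_ne_curve hG hk he he' ?_) hz hlt
    rintro rfl
    exact hlt.ne rfl
  exact ⟨a, b, c, hs, key a (by simp [hs]) b (by simp [hs]) h1,
    key b (by simp [hs]) c (by simp [hs]) h2⟩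

namespace IsSortedCut

variable {k : ℕ} {a b c : E}

theorem lower_mem (h : R.IsSortedCut k a b c) : a ∈ G.cut k := by simp [h.cut_eq]

theorem middle_mem (h : R.IsSortedCut k a b c) : b ∈ G.cut k := by simp [h.cut_eq]

theorem upper_mem (h : R.IsSortedCut k a b c) : c ∈ G.cut k := by simp [h.cut_eq]

theorem lower_le [Finite E] (h : R.IsSortedCut k a b c) (hG : G.IsFull 3) (hk : k < n) :
    ∀ x ∈ Set.Icc (R.abscissa k) (R.abscissa (k + 1)), R.curve a x ≤ R.curve b x :=
  le_on_Icc_of_lt_on_Ioo (abscissa_lt_succ hG hk) (continuousOn_curve hG h.lower_mem)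
    (continuousOn_curve hG h.middle_mem) h.lower_lt

theorem le_upper [Finite E] (h : R.IsSortedCut k a b c) (hG : G.IsFull 3) (hk : k < n) :
    ∀ x ∈ Set.Icc (R.abscissa k) (R.abscissa (k + 1)), R.curve b x ≤ R.curve c x :=
  le_on_Icc_of_lt_on_Ioo (abscissa_lt_succ hG hk) (continuousOn_curve hG h.middle_mem)
    (continuousOn_curve hG h.upper_mem) h.lt_upper

/-- If all edges but `p` run to the point `(x, y)`, then `p` is not the middle edge, since that is
squeezed between the other two. -/
theorem passing_edge [Finite E] (h : R.IsSortedCut k a b c) (hG : G.IsFull 3) (hk : k < n) {p : E}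
    (hp : p ∈ G.cut k) {x y : ℝ} (hx : x ∈ Set.Icc (R.abscissa k) (R.abscissa (k + 1)))
    (hne : R.curve p x ≠ y) (heq : ∀ e ∈ G.cut k, e ≠ p → R.curve e x = y) :
    (p = c ∧ R.curve a x = y ∧ R.curve b x = y ∧ y < R.curve c x) ∨
      (p = a ∧ R.curve b x = y ∧ R.curve c x = y ∧ R.curve a x < y) := by
  obtain ⟨z, hz⟩ := Set.nonempty_Ioo.2 (abscissa_lt_succ (R := R) hG hk)
  have h1 := h.lower_lt z hz
  have h2 := h.lt_upper z hz
  have hab : a ≠ b := by rintro rfl; exact h1.ne rfl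
  have hbc : b ≠ c := by rintro rfl; exact h2.ne rfl
  have hac : a ≠ c := by rintro rfl; exact h1.not_gt h2
  have h3 := h.lower_le hG hk x hx
  have h4 := h.le_upper hG hk x hx
  have ha := heq a h.lower_mem
  have hb := heq b h.middle_mem
  have hc := heq c h.upper_mem
  rw [h.cut_eq] at hp
  rcases hp with rfl | rfl | rfl
  · have hb := hb hab.symm
    exact Or.inr ⟨rfl, hb, hc hac.symm, lt_of_le_of_ne (hb ▸ h3) hne⟩
  · exact absurd (le_antisymm (h4.trans (hc hbc.symm).le) ((ha hab).ge.trans h3)) hne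
  · have hb := hb hbc
    exact Or.inl ⟨rfl, ha hac, hb, lt_of_le_of_ne (hb ▸ h4) hne.symm⟩

/-- At an inner vertex the middle edges of the two adjacent cuts meet, together with either the
two lower or the two upper edges; the third edge passes by. -/
theorem at_vertex [Finite E] {a' b' c' : E} (h : R.IsSortedCut k a b c)
    (h' : R.IsSortedCut (k + 1) a' b' c') (hG : G.IsFull 3) (hk : k + 1 < n) :
    (G.tgt b : ℕ) = k + 1 ∧ (G.src b' : ℕ) = k + 1 ∧
    ((c' = c ∧ R.curve a (R.abscissa (k + 1)) = R.ordinate (k + 1) ∧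
        R.curve a' (R.abscissa (k + 1)) = R.ordinate (k + 1) ∧
        R.ordinate (k + 1) < R.curve c (R.abscissa (k + 1))) ∨
      (a' = a ∧ R.curve c (R.abscissa (k + 1)) = R.ordinate (k + 1) ∧
        R.curve c' (R.abscissa (k + 1)) = R.ordinate (k + 1) ∧
        R.curve a (R.abscissa (k + 1)) < R.ordinate (k + 1))) := by
  obtain ⟨p, hp, hp', hin, hout⟩ := hG.exists_passing_edge hk
  have hk' : k < n := by omega
  have hne : R.curve p (R.abscissa (k + 1)) ≠ R.ordinate (k + 1) :=
    curve_ne_ordinate hG (Nat.lt_succ_of_le hp.1) hp'.2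
  have h1 := h.passing_edge hG hk' hp (Set.right_mem_Icc.2 (abscissa_lt_succ hG hk').le) hne
    fun e he hep => curve_eq_of_tgt (hin e he hep)
  have h2 := h'.passing_edge hG hk hp' (Set.left_mem_Icc.2 (abscissa_lt_succ hG hk).le) hne
    fun e he hep => curve_eq_of_src (hout e he hep)
  refine ⟨hin b h.middle_mem ?_, hout b' h'.middle_mem ?_, ?_⟩
  · rintro rfl
    rcases h1 with h1 | h1
    · exact hne h1.2.2.1
    · exact hne h1.2.1
  · rintro rfl
    rcases h2 with h2 | h2
    · exact hne h2.2.2.1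
    · exact hne h2.2.1
  · rcases h1 with ⟨rfl, h1⟩ | ⟨rfl, h1⟩ <;> rcases h2 with ⟨h2', h2⟩ | ⟨h2', h2⟩
    · exact Or.inl ⟨h2'.symm, h1.1, h2.1, h1.2.2⟩
    · subst h2'; exact absurd h1.2.2 h2.2.2.not_gt
    · subst h2'; exact absurd h1.2.2 h2.2.2.not_gt
    · exact Or.inr ⟨h2'.symm, h1.2.1, h2.2.1, h1.2.2⟩

theorem src_middle [Finite E] (h : R.IsSortedCut k a b c) (hG : G.IsFull 3) (hk : k < n) :
    (G.src b : ℕ) = k := by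
  have hb := h.middle_mem.1
  rcases Nat.eq_zero_or_pos k with rfl | h0
  · omega
  · obtain ⟨j, rfl⟩ : ∃ j, k = j + 1 := ⟨k - 1, by omega⟩
    obtain ⟨a', b', c', h'⟩ := exists_isSortedCut (R := R) hG (k := j) (by omega)
    exact (h'.at_vertex h hG hk).2.1

theorem tgt_middle [Finite E] (h : R.IsSortedCut k a b c) (hG : G.IsFull 3) (hk : k < n) :
    (G.tgt b : ℕ) = k + 1 := by
  have hb := h.middle_mem.2
  have hb' := (G.tgt b).2
  rcases Nat.lt_or_ge (k + 1) n with h0 | h0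
  · obtain ⟨a', b', c', h'⟩ := exists_isSortedCut (R := R) hG h0
    exact (h.at_vertex h' hG h0).1
  · omega

end IsSortedCut

variable (R)

/-- The drawing consists of the graphs of three functions `L ≤ M ≤ H` over `[X 0, X n]`, made up of
the lower edges `a k`, the middle edges `b k` and the upper edges `c k` of the cuts; at every
inner vertex exactly one of `L` and `H` touches `M`. -/
structure IsStrandSystem (a b c : ℕ → E) (L M H : ℝ → ℝ) : Prop where
  sorted : ∀ k < n, R.IsSortedCut k (a k) (b k) (c k)
  lower : IsPinchedStrip L M R.abscissa n
  upper : IsPinchedStrip M H R.abscissa n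
  eq_lower : ∀ k < n, ∀ x ∈ Set.Icc (R.abscissa k) (R.abscissa (k + 1)), L x = R.curve (a k) x
  eq_middle : ∀ k < n, ∀ x ∈ Set.Icc (R.abscissa k) (R.abscissa (k + 1)), M x = R.curve (b k) x
  eq_upper : ∀ k < n, ∀ x ∈ Set.Icc (R.abscissa k) (R.abscissa (k + 1)), H x = R.curve (c k) x
  pinch : ∀ k, k + 1 < n →
    (L (R.abscissa (k + 1)) = M (R.abscissa (k + 1)) ∧
      M (R.abscissa (k + 1)) ≠ H (R.abscissa (k + 1))) ∨
    (L (R.abscissa (k + 1)) ≠ M (R.abscissa (k + 1)) ∧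
      M (R.abscissa (k + 1)) = H (R.abscissa (k + 1)))

variable {R}

theorem exists_isStrandSystem [Finite E] (hG : G.IsFull 3) :
    ∃ a b c L M H, R.IsStrandSystem a b c L M H := by
  have hn := hG.pos
  have hE : Nonempty E := ⟨(hG.exists_short_edge hn).choose⟩
  have hex : ∀ k, ∃ a b c, k < n → R.IsSortedCut k a b c := by
    intro k
    by_cases hk : k < n
    · obtain ⟨a, b, c, h⟩ := exists_isSortedCut (R := R) hG hk
      exact ⟨a, b, c, fun _ => h⟩
    · exact ⟨hE.some, hE.some, hE.some, fun h => absurd h hk⟩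
  choose a b c hs using hex
  have hlt : ∀ k < n, R.abscissa k < R.abscissa (k + 1) := fun k hk => abscissa_lt_succ hG hk
  have hbl : ∀ k < n, R.curve (b k) (R.abscissa k) = R.ordinate k :=
    fun k hk => curve_eq_of_src ((hs k hk).src_middle hG hk)
  have hbr : ∀ k < n, R.curve (b k) (R.abscissa (k + 1)) = R.ordinate (k + 1) :=
    fun k hk => curve_eq_of_tgt ((hs k hk).tgt_middle hG hk)
  have hv : ∀ k (hk : k + 1 < n), _ := fun k hk =>
    ((hs k (by omega)).at_vertex (hs (k + 1) hk) hG hk).2.2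
  obtain ⟨L, hLc, hL⟩ := exists_continuous_glue R.abscissa n hlt (fun k => R.curve (a k))
    (fun k hk => continuousOn_curve hG (hs k hk).lower_mem) (fun k hk => by
      rcases hv k hk with ⟨-, h1, h2, -⟩ | ⟨h1, -⟩
      · exact h1.trans h2.symm
      · rw [h1])
  obtain ⟨M, hMc, hM⟩ := exists_continuous_glue R.abscissa n hlt (fun k => R.curve (b k))
    (fun k hk => continuousOn_curve hG (hs k hk).middle_mem)
    (fun k hk => (hbr k (by omega)).trans (hbl _ hk).symm)
  obtain ⟨H, hHc, hH⟩ := exists_continuous_glue R.abscissa n hlt (fun k => R.curve (c k))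
    (fun k hk => continuousOn_curve hG (hs k hk).upper_mem) (fun k hk => by
      rcases hv k hk with ⟨h1, -⟩ | ⟨-, h1, h2, -⟩
      · rw [h1]
      · exact h1.trans h2.symm)
  have hpiece : ∀ x ∈ Set.Icc (R.abscissa 0) (R.abscissa n), ∃ k < n,
      x ∈ Set.Icc (R.abscissa k) (R.abscissa (k + 1)) := fun x hx => by
    obtain ⟨k, -, hk, hxk⟩ := exists_mem_Icc_succ hx.1 hx.2 hn
    exact ⟨k, hk, hxk⟩
  have hleft : ∀ k < n, R.abscissa k ∈ Set.Icc (R.abscissa k) (R.abscissa (k + 1)) :=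
    fun k hk => Set.left_mem_Icc.2 (hlt k hk).le
  have hright : ∀ k < n, R.abscissa (k + 1) ∈ Set.Icc (R.abscissa k) (R.abscissa (k + 1)) :=
    fun k hk => Set.right_mem_Icc.2 (hlt k hk).le
  have hends : ∀ k < n, ∀ x ∈ Set.Icc (R.abscissa k) (R.abscissa (k + 1)),
      x ∉ Set.Ioo (R.abscissa k) (R.abscissa (k + 1)) → ∃ v ≤ n, x = R.abscissa v := by
    intro k hk x hx hx'
    rcases Set.eq_endpoints_or_mem_Ioo_of_mem_Icc hx with h | h | h
    · exact ⟨k, hk.le, h⟩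
    · exact ⟨k + 1, hk, h⟩
    · exact absurd h hx'
  -- at the source and at the sink all three strands meet
  have hfirst : ∀ e ∈ G.cut 0, R.curve e (R.abscissa 0) = R.ordinate 0 :=
    fun e he => curve_eq_of_src (Nat.le_zero.1 he.1)
  have hlast : ∀ e ∈ G.cut (n - 1), R.curve e (R.abscissa n) = R.ordinate n := by
    intro e he
    refine curve_eq_of_tgt ?_
    have h1 := (G.tgt e).2
    have h2 : n - 1 < (G.tgt e : ℕ) := he.2
    omega
  have hn1 : n - 1 < n := by omega
  have hnr := hright (n - 1) hn1
  rw [show n - 1 + 1 = n by omega] at hnr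
  have hnr' : R.abscissa n ∈ Set.Icc (R.abscissa (n - 1)) (R.abscissa (n - 1 + 1)) := by
    rwa [show n - 1 + 1 = n by omega]
  refine ⟨a, b, c, L, M, H, hs, ⟨hLc, hMc, fun i j => abscissa_lt hG, ?_, ?_, ?_, ?_⟩,
    ⟨hMc, hHc, fun i j => abscissa_lt hG, ?_, ?_, ?_, ?_⟩, hL, hM, hH, ?_⟩
  · intro x hx
    obtain ⟨k, hk, hxk⟩ := hpiece x hx
    rw [hL k hk x hxk, hM k hk x hxk]
    exact (hs k hk).lower_le hG hk x hxk
  · intro x hx he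
    obtain ⟨k, hk, hxk⟩ := hpiece x hx
    rw [hL k hk x hxk, hM k hk x hxk] at he
    exact hends k hk x hxk fun h => ((hs k hk).lower_lt x h).ne he
  · rw [hL 0 hn _ (hleft 0 hn), hM 0 hn _ (hleft 0 hn), hfirst _ (hs 0 hn).lower_mem,
      hfirst _ (hs 0 hn).middle_mem]
  · rw [hL _ hn1 _ hnr', hM _ hn1 _ hnr', hlast _ (hs _ hn1).lower_mem,
      hlast _ (hs _ hn1).middle_mem]
  · intro x hx
    obtain ⟨k, hk, hxk⟩ := hpiece x hx
    rw [hM k hk x hxk, hH k hk x hxk]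
    exact (hs k hk).le_upper hG hk x hxk
  · intro x hx he
    obtain ⟨k, hk, hxk⟩ := hpiece x hx
    rw [hM k hk x hxk, hH k hk x hxk] at he
    exact hends k hk x hxk fun h => ((hs k hk).lt_upper x h).ne he
  · rw [hM 0 hn _ (hleft 0 hn), hH 0 hn _ (hleft 0 hn), hfirst _ (hs 0 hn).middle_mem,
      hfirst _ (hs 0 hn).upper_mem]
  · rw [hM _ hn1 _ hnr', hH _ hn1 _ hnr', hlast _ (hs _ hn1).middle_mem,
      hlast _ (hs _ hn1).upper_mem]
  · intro k hk
    have hk' : k < n := by omega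
    rw [hL k hk' _ (hright k hk'), hM k hk' _ (hright k hk'), hH k hk' _ (hright k hk'),
      hbr k hk']
    rcases hv k hk with ⟨-, h1, -, h2⟩ | ⟨-, h1, -, h2⟩
    · exact Or.inl ⟨h1, h2.ne⟩
    · exact Or.inr ⟨h2.ne, h1.symm⟩

namespace IsStrandSystem

variable {a b c : ℕ → E} {L M H : ℝ → ℝ}

theorem mem_drawing_iff [Finite E] (h : R.IsStrandSystem a b c L M H) (hG : G.IsFull 3)
    (p : ℝ × ℝ) : p ∈ R.drawing ↔ p.1 ∈ Set.Icc (R.abscissa 0) (R.abscissa n) ∧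
      (p.2 = L p.1 ∨ p.2 = M p.1 ∨ p.2 = H p.1) := by
  have hn := hG.pos
  -- every edge is part of one of the strands
  have harc : ∀ e, ∀ q ∈ R.arc e, q.1 ∈ Set.Icc (R.abscissa 0) (R.abscissa n) ∧
      (q.2 = L q.1 ∨ q.2 = M q.1 ∨ q.2 = H q.1) := by
    rintro e _ ⟨x, hx, rfl⟩
    have hs : (G.src e : ℕ) < G.tgt e := G.src_lt_tgt e
    have ht := (G.tgt e).2
    rw [← abscissa_val, ← abscissa_val] at hx
    obtain ⟨k, hk1, hk2, hxk⟩ := exists_mem_Icc_succ hx.1 hx.2 hs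
    have hk : k < n := by omega
    refine ⟨⟨(abscissa_le hG (Nat.zero_le _) (by omega)).trans hx.1,
      hx.2.trans (abscissa_le hG (by omega) le_rfl)⟩, ?_⟩
    have he : e ∈ G.cut k := ⟨hk1, hk2⟩
    dsimp only
    rw [h.eq_lower k hk x hxk, h.eq_middle k hk x hxk, h.eq_upper k hk x hxk]
    rw [(h.sorted k hk).cut_eq] at he
    rcases he with rfl | rfl | rfl
    · exact Or.inl rfl
    · exact Or.inr (Or.inl rfl)
    · exact Or.inr (Or.inr rfl)
  constructor
  · rintro (⟨v, rfl⟩ | hp)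
    · -- every vertex is an end of some edge
      obtain ⟨e, he⟩ : ∃ e, v = G.src e ∨ v = G.tgt e := by
        rcases Nat.lt_or_ge (v : ℕ) n with hv | hv
        · obtain ⟨e, he, -⟩ := hG.exists_short_edge hv
          exact ⟨e, Or.inl (Fin.ext he.symm)⟩
        · obtain ⟨e, -, he⟩ := hG.exists_short_edge (k := n - 1) (by omega)
          have hv' := v.2
          exact ⟨e, Or.inr (Fin.ext (by omega))⟩
      refine harc e _ ?_
      rcases he with rfl | rfl
      · exact ⟨_, Set.left_mem_Icc.2 (R.left_to_right e).le, by simp [R.curve_src]⟩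
      · exact ⟨_, Set.right_mem_Icc.2 (R.left_to_right e).le, by simp [R.curve_tgt]⟩
    · obtain ⟨e, he⟩ := Set.mem_iUnion.1 hp
      exact harc e p he
  · rintro ⟨hx, hy⟩
    obtain ⟨k, -, hk, hxk⟩ := exists_mem_Icc_succ hx.1 hx.2 hn
    have hmem : ∀ e ∈ G.cut k, p.2 = R.curve e p.1 → p ∈ R.drawing := fun e he hpe =>
      Or.inr (Set.mem_iUnion.2 ⟨e, p.1, Icc_subset_of_mem_cut hG he hxk, Prod.ext rfl hpe.symm⟩)
    rw [h.eq_lower k hk _ hxk, h.eq_middle k hk _ hxk, h.eq_upper k hk _ hxk] at hy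
    rcases hy with hy | hy | hy
    · exact hmem _ (h.sorted k hk).lower_mem hy
    · exact hmem _ (h.sorted k hk).middle_mem hy
    · exact hmem _ (h.sorted k hk).upper_mem hy

end IsStrandSystem

end StronglyPlanarRealization

/-! ### The bounded faces and the truncated dual -/

namespace StronglyPlanarRealization

variable {n : ℕ} {E : Type*} {G : OrderedDAG n E} {R : StronglyPlanarRealization G}

/-- A face containing a point from which a ray avoids the drawing is unbounded. -/
theorem not_isBounded_of_ray {F : Set (ℝ × ℝ)} (hF : F ∈ R.faces) {p d : ℝ × ℝ} (hp : p ∈ F)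
    (hd : d ≠ 0) (hray : ∀ t : ℝ, 0 ≤ t → p + t • d ∉ R.drawing) : ¬ Bornology.IsBounded F := by
  intro hb
  obtain ⟨q, -, rfl⟩ := hF
  rw [connectedComponentIn_eq hp] at hb
  have hc : IsPreconnected ((fun t : ℝ => p + t • d) '' Set.Ici 0) :=
    isPreconnected_Ici.image _ (Continuous.continuousOn (by fun_prop))
  have hsub := hc.subset_connectedComponentIn (F := R.drawingᶜ) (x := p)
    ⟨0, Set.self_mem_Ici, by simp⟩
    (by rintro _ ⟨t, ht, rfl⟩; exact hray t ht)
  obtain ⟨C, hC⟩ := (hb.subset hsub).exists_norm_le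
  have hd' : 0 < ‖d‖ := norm_pos_iff.2 hd
  have hC0 : ‖p‖ ≤ C := hC p ⟨0, Set.self_mem_Ici, by simp⟩
  have ht : 0 ≤ (C + ‖p‖ + 1) / ‖d‖ :=
    div_nonneg (by linarith [norm_nonneg p]) hd'.le
  have h1 := hC _ ⟨_, ht, rfl⟩
  have h2 : ‖((C + ‖p‖ + 1) / ‖d‖) • d‖ = C + ‖p‖ + 1 := by
    rw [norm_smul, Real.norm_of_nonneg ht, div_mul_cancel₀ _ hd'.ne']
  have h3 := norm_sub_le (p + ((C + ‖p‖ + 1) / ‖d‖) • d) p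
  rw [add_sub_cancel_left, h2] at h3
  dsimp only at h1
  linarith

namespace IsStrandSystem

variable {a b c : ℕ → E} {L M H : ℝ → ℝ}

theorem lower_ne_upper (h : R.IsStrandSystem a b c L M H) {j k : ℕ} (hj : j < n) :
    stripCell L M R.abscissa n j ≠ stripCell M H R.abscissa n k := by
  intro he
  obtain ⟨p, hp, -⟩ := h.lower.exists_mem_cell hj
  have hp' : p ∈ stripCell M H R.abscissa n k := he ▸ hp
  exact hp.2.2.not_gt hp'.2.1

variable [Finite E]

/-- A bounded face lies between the lower and the upper strand. -/
theorem between_of_isBounded (h : R.IsStrandSystem a b c L M H) (hG : G.IsFull 3)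
    {F : Set (ℝ × ℝ)} (hF : F ∈ R.faces) (hb : Bornology.IsBounded F) {p : ℝ × ℝ} (hp : p ∈ F) :
    p.1 ∈ Set.Icc (R.abscissa 0) (R.abscissa n) ∧ L p.1 < p.2 ∧ p.2 < H p.1 := by
  have hpD : p ∉ R.drawing := by
    obtain ⟨q, -, rfl⟩ := hF
    exact connectedComponentIn_subset _ _ hp
  have hray := fun d hd => mt (not_isBounded_of_ray hF (d := d) hp hd) (not_not.2 hb)
  simp only [h.mem_drawing_iff hG, Prod.fst_add, Prod.snd_add, Prod.smul_fst, Prod.smul_snd,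
    smul_eq_mul] at hray hpD
  have hx : p.1 ∈ Set.Icc (R.abscissa 0) (R.abscissa n) := by
    constructor
    · by_contra hcon
      refine hray (-1, 0) (by simp) fun t ht hmem => ?_
      have := hmem.1.1
      dsimp only at this
      linarith
    · by_contra hcon
      refine hray (1, 0) (by simp) fun t ht hmem => ?_
      have := hmem.1.2
      dsimp only at this
      linarith
  have h1 := h.lower.le _ hx
  have h2 := h.upper.le _ hx
  refine ⟨hx, ?_, ?_⟩
  · by_contra hcon
    have hlt : p.2 < L p.1 := lt_of_le_of_ne (not_lt.1 hcon) fun he => hpD ⟨hx, Or.inl he⟩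
    refine hray (0, -1) (by simp) fun t ht hmem => ?_
    have := hmem.2
    simp only [mul_zero, add_zero] at this
    rcases this with h3 | h3 | h3 <;> linarith
  · by_contra hcon
    have hlt : H p.1 < p.2 :=
      lt_of_le_of_ne (not_lt.1 hcon) fun he => hpD ⟨hx, Or.inr (Or.inr he.symm)⟩
    refine hray (0, 1) (by simp) fun t ht hmem => ?_
    have := hmem.2
    simp only [mul_zero, add_zero] at this
    rcases this with h3 | h3 | h3 <;> linarith

theorem component_lower (h : R.IsStrandSystem a b c L M H) (hG : G.IsFull 3) {k : ℕ}
    (hk : k < n) {p : ℝ × ℝ} (hp : p ∈ stripCell L M R.abscissa n k) :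
    p ∈ R.drawingᶜ ∧ connectedComponentIn R.drawingᶜ p = stripCell L M R.abscissa n k := by
  have hsub : stripCell L M R.abscissa n k ⊆ R.drawingᶜ := by
    intro q hq hqD
    obtain ⟨hx, hy⟩ := (h.mem_drawing_iff hG q).1 hqD
    have h1 := h.upper.le _ hx
    have h2 := hq.2
    rcases hy with hy | hy | hy <;> linarith
  refine ⟨hsub hp, connectedComponentIn_eq_of_closure_inter_subset h.lower.isOpen_cell
    (h.lower.isPreconnected_cell hk) hsub (h.lower.closure_cell_inter_subset hk ?_ ?_) hp⟩
  · exact fun q hq hx he => hq ((h.mem_drawing_iff hG q).2 ⟨hx, Or.inl he⟩)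
  · exact fun q hq hx he => hq ((h.mem_drawing_iff hG q).2 ⟨hx, Or.inr (Or.inl he)⟩)

theorem component_upper (h : R.IsStrandSystem a b c L M H) (hG : G.IsFull 3) {k : ℕ}
    (hk : k < n) {p : ℝ × ℝ} (hp : p ∈ stripCell M H R.abscissa n k) :
    p ∈ R.drawingᶜ ∧ connectedComponentIn R.drawingᶜ p = stripCell M H R.abscissa n k := by
  have hsub : stripCell M H R.abscissa n k ⊆ R.drawingᶜ := by
    intro q hq hqD
    obtain ⟨hx, hy⟩ := (h.mem_drawing_iff hG q).1 hqD
    have h1 := h.lower.le _ hx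
    have h2 := hq.2
    rcases hy with hy | hy | hy <;> linarith
  refine ⟨hsub hp, connectedComponentIn_eq_of_closure_inter_subset h.upper.isOpen_cell
    (h.upper.isPreconnected_cell hk) hsub (h.upper.closure_cell_inter_subset hk ?_ ?_) hp⟩
  · exact fun q hq hx he => hq ((h.mem_drawing_iff hG q).2 ⟨hx, Or.inr (Or.inl he)⟩)
  · exact fun q hq hx he => hq ((h.mem_drawing_iff hG q).2 ⟨hx, Or.inr (Or.inr he)⟩)

theorem lower_mem_faces (h : R.IsStrandSystem a b c L M H) (hG : G.IsFull 3) {k : ℕ}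
    (hk : k < n) : stripCell L M R.abscissa n k ∈ R.faces := by
  obtain ⟨p, hp, -⟩ := h.lower.exists_mem_cell hk
  obtain ⟨h1, h2⟩ := h.component_lower hG hk hp
  exact ⟨p, h1, h2.symm⟩

theorem upper_mem_faces (h : R.IsStrandSystem a b c L M H) (hG : G.IsFull 3) {k : ℕ}
    (hk : k < n) : stripCell M H R.abscissa n k ∈ R.faces := by
  obtain ⟨p, hp, -⟩ := h.upper.exists_mem_cell hk
  obtain ⟨h1, h2⟩ := h.component_upper hG hk hp
  exact ⟨p, h1, h2.symm⟩

/-- The vertices of the truncated dual are the cells of the two strips. -/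
theorem mem_vertexSet_truncatedDual (h : R.IsStrandSystem a b c L M H) (hG : G.IsFull 3)
    (F : Set (ℝ × ℝ)) : F ∈ R.truncatedDual.vertexSet ↔
      ∃ k < n, F = stripCell L M R.abscissa n k ∨ F = stripCell M H R.abscissa n k := by
  rw [truncatedDual, Graph.vertexSet_deleteVerts]
  constructor
  · rintro ⟨hF, hb⟩
    have hF : F ∈ R.faces := hF
    have hb : Bornology.IsBounded F := not_not.1 hb
    obtain ⟨p, hpD, hFp⟩ := id hF
    have hp : p ∈ F := hFp ▸ mem_connectedComponentIn hpD
    obtain ⟨hx, h1, h2⟩ := h.between_of_isBounded hG hF hb hp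
    rcases lt_trichotomy p.2 (M p.1) with h3 | h3 | h3
    · obtain ⟨k, hk, hpk⟩ := h.lower.exists_cell hx h1 h3
      exact ⟨k, hk, Or.inl (hFp.trans (h.component_lower hG hk hpk).2)⟩
    · exact absurd ((h.mem_drawing_iff hG p).2 ⟨hx, Or.inr (Or.inl h3)⟩) hpD
    · obtain ⟨k, hk, hpk⟩ := h.upper.exists_cell hx h3 h2
      exact ⟨k, hk, Or.inr (hFp.trans (h.component_upper hG hk hpk).2)⟩
  · rintro ⟨k, hk, rfl | rfl⟩
    · exact ⟨h.lower_mem_faces hG hk, not_not.2 (h.lower.isBounded_cell hk)⟩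
    · exact ⟨h.upper_mem_faces hG hk, not_not.2 (h.upper.isBounded_cell hk)⟩

theorem span_middle (h : R.IsStrandSystem a b c L M H) (hG : G.IsFull 3) {k : ℕ} (hk : k < n) :
    R.span (b k) = Set.Ioo (R.abscissa k) (R.abscissa (k + 1)) := by
  rw [span, ← abscissa_val, ← abscissa_val, (h.sorted k hk).src_middle hG hk,
    (h.sorted k hk).tgt_middle hG hk]

theorem isBelow_middle (h : R.IsStrandSystem a b c L M H) (hG : G.IsFull 3) {k : ℕ}
    (hk : k < n) : R.IsBelow (stripCell L M R.abscissa n k) (b k) := by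
  refine ⟨h.lower_mem_faces hG hk, fun x hx => ?_⟩
  rw [h.span_middle hG hk] at hx
  have hx' := Set.Ioo_subset_Icc_self hx
  have hlt := h.lower.lt_of_mem_base hk (h.lower.Ioo_subset_base hk hx)
  rw [← h.eq_middle k hk x hx']
  filter_upwards [Ioo_mem_nhdsGT (sub_pos.2 hlt)] with ε hε
  exact h.lower.mem_cell hk hx (by dsimp; linarith [hε.2]) (by dsimp; linarith [hε.1])

theorem isAbove_middle (h : R.IsStrandSystem a b c L M H) (hG : G.IsFull 3) {k : ℕ}
    (hk : k < n) : R.IsAbove (stripCell M H R.abscissa n k) (b k) := by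
  refine ⟨h.upper_mem_faces hG hk, fun x hx => ?_⟩
  rw [h.span_middle hG hk] at hx
  have hx' := Set.Ioo_subset_Icc_self hx
  have hlt := h.upper.lt_of_mem_base hk (h.upper.Ioo_subset_base hk hx)
  rw [← h.eq_middle k hk x hx']
  filter_upwards [Ioo_mem_nhdsGT (sub_pos.2 hlt)] with ε hε
  exact h.upper.mem_cell hk hx (by dsimp; linarith [hε.1]) (by dsimp; linarith [hε.2])

/-- Only the middle edges have bounded faces on both sides. -/
theorem eq_middle_of_isBelow_of_isAbove (h : R.IsStrandSystem a b c L M H) (hG : G.IsFull 3)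
    {e : E} {F F' : Set (ℝ × ℝ)} (hF : R.IsBelow F e) (hF' : R.IsAbove F' e)
    (hb : Bornology.IsBounded F) (hb' : Bornology.IsBounded F') :
    ∃ k < n, e = b k ∧ F = stripCell L M R.abscissa n k ∧ F' = stripCell M H R.abscissa n k := by
  have hs : (G.src e : ℕ) < G.tgt e := G.src_lt_tgt e
  have ht := (G.tgt e).2
  obtain ⟨k, hke⟩ : ∃ k : ℕ, k = (G.src e : ℕ) := ⟨_, rfl⟩
  have hk : k < n := by omega
  have he : e ∈ G.cut k := ⟨hke.ge, by omega⟩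
  obtain ⟨x, hx⟩ := Set.nonempty_Ioo.2 (abscissa_lt_succ (R := R) hG hk)
  have hx' := Set.Ioo_subset_Icc_self hx
  have hxe : x ∈ R.span e := by
    rw [span, ← abscissa_val, ← abscissa_val, ← hke]
    exact ⟨hx.1, hx.2.trans_le (abscissa_le hG (by omega) (by omega))⟩
  obtain ⟨ε, hεF, hε⟩ := ((hF.2 x hxe).and self_mem_nhdsWithin).exists
  obtain ⟨δ, hδF, hδ⟩ := ((hF'.2 x hxe).and self_mem_nhdsWithin).exists
  have hε : 0 < ε := hε
  have hδ : 0 < δ := hδ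
  rw [(h.sorted k hk).cut_eq] at he
  rcases he with rfl | rfl | rfl
  · have h1 := (h.between_of_isBounded hG hF.1 hb hεF).2.1
    dsimp only at h1
    rw [h.eq_lower k hk x hx'] at h1
    linarith
  · exact ⟨k, hk, rfl, hF.eq (h.isBelow_middle hG hk), hF'.eq (h.isAbove_middle hG hk)⟩
  · have h1 := (h.between_of_isBounded hG hF'.1 hb' hδF).2.2
    dsimp only at h1
    rw [h.eq_upper k hk x hx'] at h1
    linarith

theorem isTwoRowCaterpillar (h : R.IsStrandSystem a b c L M H) (hG : G.IsFull 3) :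
    R.truncatedDual.IsTwoRowCaterpillar (stripCell L M R.abscissa n)
      (stripCell M H R.abscissa n) b n where
  mem_vertexSet := h.mem_vertexSet_truncatedDual hG
  isLink e F F' := by
    rw [truncatedDual, Graph.deleteVerts_isLink]
    constructor
    · rintro ⟨⟨h1, h2⟩ | ⟨h1, h2⟩, hb, hb'⟩
      · obtain ⟨k, hk, he, hF⟩ :=
          h.eq_middle_of_isBelow_of_isAbove hG h1 h2 (not_not.1 hb) (not_not.1 hb')
        exact ⟨k, hk, he, Or.inl hF⟩
      · obtain ⟨k, hk, he, hF⟩ :=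
          h.eq_middle_of_isBelow_of_isAbove hG h1 h2 (not_not.1 hb') (not_not.1 hb)
        exact ⟨k, hk, he, Or.inr hF.symm⟩
    · rintro ⟨k, hk, rfl, ⟨rfl, rfl⟩ | ⟨rfl, rfl⟩⟩
      · exact ⟨Or.inl ⟨h.isBelow_middle hG hk, h.isAbove_middle hG hk⟩,
          not_not.2 (h.lower.isBounded_cell hk), not_not.2 (h.upper.isBounded_cell hk)⟩
      · exact ⟨Or.inr ⟨h.isBelow_middle hG hk, h.isAbove_middle hG hk⟩,
          not_not.2 (h.upper.isBounded_cell hk), not_not.2 (h.lower.isBounded_cell hk)⟩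
  ne j hj k _ := h.lower_ne_upper hj
  step k hk := by
    rcases h.pinch k hk with ⟨h1, h2⟩ | ⟨h1, h2⟩
    · refine Or.inr ⟨(IsPinchedStrip.cell_congr k.le_succ fun v hv hv' _ => ?_).symm,
        fun j hj he => ?_⟩
      · obtain rfl : v = k + 1 := by omega
        exact h2
      · obtain ⟨p, hp, -⟩ := h.lower.exists_mem_cell hk
        exact (IsPinchedStrip.cell_lt_cell hk.le h1 (Nat.lt_succ_of_le hj) le_rfl
          (he ▸ hp) hp).ne rfl
    · refine Or.inl ⟨(IsPinchedStrip.cell_congr k.le_succ fun v hv hv' _ => ?_).symm,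
        fun j hj he => ?_⟩
      · obtain rfl : v = k + 1 := by omega
        exact h1
      · obtain ⟨p, hp, -⟩ := h.upper.exists_mem_cell hk
        exact (IsPinchedStrip.cell_lt_cell hk.le h2 (Nat.lt_succ_of_le hj) le_rfl
          (he ▸ hp) hp).ne rfl

end IsStrandSystem

end StronglyPlanarRealization

/-- Every full DAG on `n + 1` vertices with source of out-degree `3` is strongly planar, and for each
of its strongly planar realizations the truncated dual is a bipartite non-crossing tree on `n + 1`
vertices. The two rows are given by `rank`: dual edges go from the face below (rank `0`) to the face
above (rank `1`); the left-to-right position of a face in its row is the abscissa of an arbitrarily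
chosen point of that face. -/
theorem mainTheorem7 (n : ℕ) {E : Type*} [Finite E] (G : OrderedDAG n E) (hG : G.IsFull 3) :
    Nonempty (StronglyPlanarRealization G) ∧
    ∀ R : StronglyPlanarRealization G,
      R.truncatedDual.vertexSet.ncard = n + 1 ∧
      R.truncatedDual.IsMultigraphTree ∧
      ∃ rank : Set (ℝ × ℝ) → ℝ,
        (∀ (e : E) (F F' : Set (ℝ × ℝ)), R.truncatedDual.IsLink e F F' →
          R.IsBelow F e → R.IsAbove F' e → rank F = 0 ∧ rank F' = 1) ∧
        ∀ p : Set (ℝ × ℝ) → ℝ × ℝ, (∀ F ∈ R.truncatedDual.vertexSet, p F ∈ F) →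
          R.truncatedDual.IsBipartiteNoncrossing (fun F => ((p F).1, rank F)) := by
  classical
  refine ⟨hG.nonempty_realization, fun R => ?_⟩
  obtain ⟨a, b, c, L, M, H, h⟩ := R.exists_isStrandSystem hG
  have hT := h.isTwoRowCaterpillar hG
  refine ⟨(hT.ncard_vertexSet hG.pos).2, hT.isMultigraphTree hG.pos,
    fun F => if ∃ k < n, F = stripCell L M R.abscissa n k then 0 else 1, ?_, fun p hp => ?_⟩
  · intro e F F' hl hF hF'
    rw [StronglyPlanarRealization.truncatedDual, Graph.deleteVerts_isLink] at hl
    obtain ⟨k, hk, -, rfl, rfl⟩ := h.eq_middle_of_isBelow_of_isAbove hG hF hF'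
      (not_not.1 hl.2.1) (not_not.1 hl.2.2)
    refine ⟨if_pos ⟨k, hk, rfl⟩, if_neg ?_⟩
    rintro ⟨j, hj, he⟩
    exact h.lower_ne_upper hj he.symm
  · refine hT.isBipartiteNoncrossing (x := fun F => (p F).1) (fun k hk => if_pos ⟨k, hk, rfl⟩)
      (fun k hk => if_neg ?_) (fun j k hjk hk => ?_) (fun j k hjk hk => ?_)
    · rintro ⟨j, hj, he⟩
      exact h.lower_ne_upper hj he.symm
    · exact IsPinchedStrip.cell_eq_or_lt hjk |>.imp_right fun hlt =>
        hlt _ (hp _ ((hT.mem_vertexSet _).2 ⟨j, by omega, Or.inl rfl⟩))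
          _ (hp _ ((hT.mem_vertexSet _).2 ⟨k, hk, Or.inl rfl⟩))
    · exact IsPinchedStrip.cell_eq_or_lt hjk |>.imp_right fun hlt =>
        hlt _ (hp _ ((hT.mem_vertexSet _).2 ⟨j, by omega, Or.inr rfl⟩))
          _ (hp _ ((hT.mem_vertexSet _).2 ⟨k, hk, Or.inr rfl⟩))
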